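/- **Setting.** Let $D\subset\mathbb R^n$ be a bounded open convex set and $b\in D$ a base-point. For distinct $p,q\in D$ let $w,z\in\partial D:=\overline D\setminus D$ be the points such that $w,p,q,z$ lie in this order on a line. The Hilbert metric is $d(p,q)=\log\frac{|zp|\,|wq|}{|zq|\,|wp|}$, and the reverse-Funk metric is $r(p,q)=\log\frac{|wq|}{|wp|}$ (both $0$ if $p=q$); the latter extends continuously to $(p,q)\in D\times\overline D$. For $x\in\partial D$, the reverse-Funk horofunction $r_x:D\to\mathbb R$ is $r_x(p)=r(p,x)-r(b,x)$. For $y\in D$ let $\psi_y=d(\cdot,y)-d(b,y)$. A horofunction of the Hilbert geometry is an element of $\overline{\psi(D)}\setminus\psi(D)$, the closure being taken in the space of continuous real functions on $D$ with uniform convergence on $d$-bounded sets. It is a Busemann point if it is the limit, as $t\to\sup T$, of $\psi_{\gamma(t)}$ for some almost-geodesic $\gamma$, that is, a map $\gamma:T\to D$, where $T\subset[0,\infty)$ contains $0$ and does not contain $\sup T$, such that for every $\epsilon>0$ one has $|d(\gamma(0),\gamma(s))+d(\gamma(s),\gamma(t))-t|<\epsilon$ for all $s\le t$ in $T$ large enough.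 Let $C=\{\lambda(p,1): p\in D,\ \lambda>0\}\subset\mathbb R^{n+1}$, and identify $p\in\overline D$ with $(p,1)$. For an open convex cone $U\subset\mathbb R^{n+1}$ and $z\in U$ put $U^*=\{u:\langle u,y\rangle\ge 0\ \ \forall y\in U\}$, $M(b/z;U)=\inf\{\lambda>0:\lambda z-b\in\overline U\}$ and $Z_{U,z}=U^*\cap\{u: M(b/z;U)\langle u,z\rangle\le 1\}$. Let $I_Z$ be $0$ on $Z$ and $+\infty$ elsewhere, and let $I_Z^*(y)=\sup_u(\langle y,u\rangle-I_Z(u))$ be its Legendre–Fenchel transform. An extreme set of $C^*$ is a convex subset that contains the endpoints of every segment in $C^*$ of which it contains a relative interior point. The Busemann points of the Funk geometry on $D$ are the restrictions to $D$ of the functions $\log I^*_{Z_{E,z}}$, where $E$ is an open convex cone such that $E^*\ne\{0\}$ is a proper extreme set of $C^*$, and $z\in E$. **Theorem (compatibility).** Let $x\in\partial D$, let $E\subset\mathbb R^{n+1}$ be an open convex cone such that $E^*$ is an extreme set of $C^*$ with $\{0\}\neq E^*\neq C^*$, let $z\in E$, and let $f=\log I^*_{Z_{E,z}}|_D$. Then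 the function $r_x+f$ is a Busemann point of the Hilbert geometry on $D$ if and only if $E^*$ is contained in the exposed face $\{u\in C^*:\langle u,(x,1)\rangle=0\}$ of $C^*$ defined by $x$. -/

import Mathlib

open Set Filter Topology
open scoped RealInnerProductSpace UniformConvergence

noncomputable section

/-! ### Horofunctions and Busemann points of a non-reversible metric -/

/-- The bounded sets of the symmetrised metric `(x, y) ↦ d x y + d y x`. -/
def symBoundedSets {X : Type*} (d : X → X → ℝ) : Set (Set X) :=
  {B | ∃ R : ℝ, ∀ x ∈ B, ∀ y ∈ B, d x y + d y x ≤ R}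

/-- `ψ_z = d(·, z) - d(b, z)`. -/
def distFn {X : Type*} (d : X → X → ℝ) (b z : X) : X → ℝ :=
  fun x => d x z - d b z

/-- A function on `X`, seen in the space of real functions with the topology of uniform convergence
on the bounded sets of the symmetrised metric. (Balls are bounded sets, so the continuous functions
are closed in it: closures of sets of continuous functions may be taken here.) -/
def toUnif {X : Type*} (d : X → X → ℝ) (h : X → ℝ) : X →ᵤ[symBoundedSets d] ℝ :=
  UniformOnFun.ofFun (symBoundedSets d) h

/-- The horofunctions: the elements of `closure ψ(X) \ ψ(X)`. -/
def IsHorofunction {X : Type*} (d : X → X → ℝ) (b : X) (h : X → ℝ) : Prop :=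
  toUnif d h ∈ closure (range fun z => toUnif d (distFn d b z)) ∧ h ∉ range (distFn d b)

/-- Almost-geodesics `γ : T → X`, where `T ⊆ [0, ∞)` contains `0` and does not contain `sup T`
(that is, has no greatest element). Only the values of `γ` on `T` matter. -/
def IsAlmostGeodesic {X : Type*} (d : X → X → ℝ) (T : Set ℝ) (γ : ℝ → X) : Prop :=
  T ⊆ Ici 0 ∧ 0 ∈ T ∧ (¬ ∃ m, IsGreatest T m) ∧
    ∀ ε > 0, ∃ N ∈ T, ∀ s ∈ T, ∀ t ∈ T, N ≤ s → s ≤ t →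
      |d (γ 0) (γ s) + d (γ s) (γ t) - t| < ε

/-- A Busemann point is a horofunction that is the limit of `ψ_{γ(t)}`, as `t` tends to `sup T`
within `T`, for some almost-geodesic `γ`. -/
def IsBusemannPoint {X : Type*} (d : X → X → ℝ) (b : X) (h : X → ℝ) : Prop :=
  IsHorofunction d b h ∧ ∃ (T : Set ℝ) (γ : ℝ → X), IsAlmostGeodesic d T γ ∧
    Tendsto (fun t : T => toUnif d (distFn d b (γ t))) atTop (𝓝 (toUnif d h))

/-! ### The reverse-Funk and Hilbert geometries -/

/-- The point where the ray from `x` through `y` leaves `D` (for distinct `x`, `y` in the closure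
of a bounded open convex set `D`, not both in its boundary). -/
def exitPoint {n : ℕ} (D : Set (EuclideanSpace ℝ (Fin n))) (x y : EuclideanSpace ℝ (Fin n)) :
    EuclideanSpace ℝ (Fin n) :=
  AffineMap.lineMap x y (sSup {t : ℝ | AffineMap.lineMap x y t ∈ D})

open Classical in
/-- The reverse-Funk metric `log (|wy| / |wx|)`, where `w` is the boundary point such that
`w`, `x`, `y` lie in this order on a line. The same formula gives the continuous extension to
`y` in the closure of `D` (and `x` in `D`). -/
def revFunkDist {n : ℕ} (D : Set (EuclideanSpace ℝ (Fin n))) (x y : EuclideanSpace ℝ (Fin n)) :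
    ℝ :=
  if x = y then 0
  else Real.log (dist (exitPoint D y x) y / dist (exitPoint D y x) x)

open Classical in
/-- The Hilbert metric `log (|zx| |wy| / (|zy| |wx|))`, where `w` and `z` are the boundary points
such that `w`, `x`, `y`, `z` lie in this order on a line. -/
def hilbertDist {n : ℕ} (D : Set (EuclideanSpace ℝ (Fin n))) (x y : EuclideanSpace ℝ (Fin n)) :
    ℝ :=
  if x = y then 0
  else Real.log (dist (exitPoint D x y) x / dist (exitPoint D x y) y *
    (dist (exitPoint D y x) y / dist (exitPoint D y x) x))

/-- The reverse-Funk horofunction `r_x = rev(·, x) - rev(b, x)`, for `x` in the boundary of `D`. -/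
def revHoro {n : ℕ} (D : Set (EuclideanSpace ℝ (Fin n))) (b x : EuclideanSpace ℝ (Fin n)) :
    D → ℝ :=
  fun p => revFunkDist D p x - revFunkDist D b x

/-! ### Cones, duality, and the functions `log I*_Z` -/

/-- `ℝⁿ⁺¹`, as the Euclidean space `ℝⁿ × ℝ`. -/
abbrev HomSpace (n : ℕ) : Type := WithLp 2 (EuclideanSpace ℝ (Fin n) × ℝ)

/-- The point `(p, 1)`. -/
def homLift {n : ℕ} (p : EuclideanSpace ℝ (Fin n)) : HomSpace n := WithLp.toLp 2 (p, (1 : ℝ))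

/-- The cone `C = {λ (p, 1) | p ∈ D, λ > 0}` over `D`. -/
def coneOver {n : ℕ} (D : Set (EuclideanSpace ℝ (Fin n))) : Set (HomSpace n) :=
  {v | ∃ p ∈ D, ∃ c : ℝ, 0 < c ∧ v = c • homLift p}

/-- The closed dual cone `U* = {u | ⟪x, u⟫ ≥ 0 for all x ∈ U}`. -/
def dualCone {n : ℕ} (U : Set (HomSpace n)) : Set (HomSpace n) :=
  (ProperCone.innerDual U : Set (HomSpace n))

/-- The gauge `M(x/y; U) = inf {λ > 0 | x ≤_U λ y}`, where `x ≤_U y` means `y - x ∈ closure U`. -/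
def gaugeM {n : ℕ} (U : Set (HomSpace n)) (x y : HomSpace n) : ℝ :=
  sInf {c : ℝ | 0 < c ∧ c • y - x ∈ closure U}

/-- `Z_{U,z} = U* ∩ {u | M(b/z; U) ⟪u, z⟫ ≤ 1}`. -/
def zeroSet {n : ℕ} (b : HomSpace n) (U : Set (HomSpace n)) (z : HomSpace n) :
    Set (HomSpace n) :=
  dualCone U ∩ {u | gaugeM U b z * ⟪u, z⟫ ≤ 1}

open Classical in
/-- The characteristic function `I_Z`: `0` on `Z` and `+∞` elsewhere. -/
def charI {n : ℕ} (Z : Set (HomSpace n)) : HomSpace n → EReal :=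
  fun u => if u ∈ Z then 0 else ⊤

/-- The Legendre–Fenchel transform `f*(y) = sup_x (⟪y, x⟫ - f x)`. -/
def legendreFenchel {n : ℕ} (f : HomSpace n → EReal) : HomSpace n → EReal :=
  fun y => ⨆ x : HomSpace n, (((⟪y, x⟫ : ℝ) : EReal) - f x)

/-- The restriction to `D` of `log I*_{Z_{E,z}}`. (When `E` is an open convex cone with
`{0} ≠ E* ⊆ C*` and `z ∈ E`, the values of `I*_{Z_{E,z}}` on `D` are positive reals.) -/
def funkBusemann {n : ℕ} (D : Set (EuclideanSpace ℝ (Fin n))) (b : EuclideanSpace ℝ (Fin n))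
    (E : Set (HomSpace n)) (z : HomSpace n) : D → ℝ :=
  fun p => Real.log
    (legendreFenchel (charI (zeroSet (homLift b) E z)) (homLift (p : EuclideanSpace ℝ (Fin n)))).toReal

/-- Extreme sets: convex subsets that contain the endpoints of every segment of `A` of which they
contain a relative interior point. -/
def IsExtremeSet {n : ℕ} (A F : Set (HomSpace n)) : Prop :=
  Convex ℝ F ∧ IsExtreme ℝ A F

/-- The exposed face of `C*` defined by a point `x` of the boundary of `C`. -/
def exposedFaceAt {n : ℕ} (C : Set (HomSpace n)) (x : HomSpace n) : Set (HomSpace n) :=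
  {u ∈ dualCone C | ⟪u, x⟫ = 0}

end

/-!
Write `M(p/q; U)` for the gauge `gaugeM U p q`, and identify points of `D` with their lifts. The
metrics are logarithms of gauges of `C`: the Hilbert metric is
`d(p, q) = log M(p/q; C) + log M(q/p; C)` (`hilbertDist_eq`), and the reverse-Funk metric is
`log M(q/p; C)` (`revFunkDist_eq`). Moreover `f = log M(·/z; E) - log M(b/z; E)`
(`funkBusemann_eq`).
Put `h = r_x + f`, so that `exp h = M(x/·; C) M(·/z; E)` up to a positive constant factor.

If `h` is a Busemann point, then it is unbounded below. Indeed `d(b, ·) + h ≤ 1` far out on an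
almost-geodesic (`IsAlmostGeodesic.eventually_le`), which leaves every bounded set because `h` is
not one of the functions `ψ_y` (`frequently_le_hilbertDist`). For `u ∈ E* ⊆ C*` and every `q ∈ D`,
`0 ≤ ⟪x, u⟫ ≤ M(x/q; C) ⟪q, u⟫ ≤ M(x/q; C) M(q/z; E) ⟪z, u⟫`, a constant multiple of `exp (h q)`;
hence `⟪x, u⟫ = 0`.

Conversely, suppose that `E*` lies in the exposed face of `x`. It suffices to find points `y` for
which `ψ_y` tends to `h`, `d(b, y)` tends to infinity and `d(b, y) + h y` tends to `0`
(`isBusemannPoint_of_seq`). The extremality of `E*` in `C*` means that the cone `E` is downward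
directed for the order of `C` (`exists_common_lower_bound`, by the Hahn–Banach theorem on pairs of
vectors). So the functions `M(·/(z - e); C)`, for `e ∈ E` with `z - e ∈ C`, come as close as desired
to their lower bound `M(·/z; E)` on a given compact set (`exists_gaugeM_le_mul_gaugeM`). Then
`y = μ x + (z - e)`, with `μ` large, is a point as required (`exists_realising_point`): it is
projectively close to `x`, dominates both `μ x` and `z - e` in the order of `C`, and is still below
`z` in the order of `E`, since the forms in `E*` vanish at `x`.
-/

/-! ### Open convex cones and their duals -/

section Cones

variable {V : Type*} [NormedAddCommGroup V] [InnerProductSpace ℝ V]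

variable (K : ConvexCone ℝ V)

theorem add_mem_closure_cone {v w : V} (hv : v ∈ closure (K : Set V))
    (hw : w ∈ closure (K : Set V)) : v + w ∈ closure (K : Set V) :=
  map_mem_closure₂ continuous_add hv hw fun _ ha _ hb => K.add_mem ha hb

theorem smul_mem_closure_cone {v : V} {c : ℝ} (hc : 0 < c)
    (hv : v ∈ closure (K : Set V)) : c • v ∈ closure (K : Set V) :=
  map_mem_closure (continuous_const_smul c) hv fun _ ha => K.smul_mem hc ha

theorem zero_mem_closure_cone {y : V} (hy : y ∈ K) :
    (0 : V) ∈ closure (K : Set V) := by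
  have hc : Tendsto (fun t : ℝ => t • y) (𝓝[>] 0) (𝓝 0) := by
    have : ContinuousAt (fun t : ℝ => t • y) 0 := by fun_prop
    simpa [ContinuousAt] using this.mono_left (nhdsWithin_le_nhds (s := Ioi (0 : ℝ)))
  exact mem_closure_of_tendsto hc
    (eventually_of_mem self_mem_nhdsWithin fun t ht => K.smul_mem ht hy)

variable {K}

theorem add_mem_of_mem_closure (hK : IsOpen (K : Set V)) {v w : V}
    (hv : v ∈ closure (K : Set V)) (hw : w ∈ K) : v + w ∈ K := by
  have ho : IsOpen {a : V | v + w - a ∈ (K : Set V)} :=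
    hK.preimage (by fun_prop)
  obtain ⟨a, ha, haK⟩ := mem_closure_iff.1 hv _ ho (by simpa using hw)
  have := K.add_mem ha haK
  simpa using this

variable [CompleteSpace V]

theorem inner_nonneg_of_mem_closure {U : Set V} {u w : V}
    (hu : u ∈ ProperCone.innerDual U) (hw : w ∈ closure U) : 0 ≤ ⟪w, u⟫ :=
  closure_minimal (t := {w | 0 ≤ ⟪w, u⟫}) (fun v hv => hu hv)
    (isClosed_le continuous_const (by fun_prop)) hw

theorem inner_pos_of_mem {U : Set V} (hU : IsOpen U) {u w : V}
    (hu : u ∈ ProperCone.innerDual U) (hu0 : u ≠ 0) (hw : w ∈ U) : 0 < ⟪w, u⟫ := by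
  have hc : ContinuousAt (fun t : ℝ => w - t • u) 0 := by fun_prop
  have h1 : ∀ᶠ t : ℝ in 𝓝 0, w - t • u ∈ U :=
    hc.eventually_mem (hU.mem_nhds (by simpa using hw))
  obtain ⟨t, ht, ht0⟩ := ((h1.filter_mono nhdsWithin_le_nhds).and
    (self_mem_nhdsWithin : Ioi (0 : ℝ) ∈ 𝓝[>] 0)).exists
  have h2 : 0 ≤ ⟪w - t • u, u⟫ := hu ht
  rw [inner_sub_left, inner_smul_left, real_inner_self_eq_norm_sq] at h2
  have h3 : 0 < t * ‖u‖ ^ 2 := mul_pos ht0 (by positivity)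
  simp only [conj_trivial] at h2
  linarith

/-- The bipolar theorem for the closure of a convex cone. -/
theorem mem_closure_cone_of_forall_dual {y w : V} (hy : y ∈ K)
    (h : ∀ u ∈ ProperCone.innerDual (K : Set V), 0 ≤ ⟪w, u⟫) :
    w ∈ closure (K : Set V) := by
  by_contra hw
  obtain ⟨f, s, hfs, hs⟩ := geometric_hahn_banach_point_closed K.convex.closure isClosed_closure hw
  have hs0 : s < 0 := by simpa using hs 0 (zero_mem_closure_cone K hy)
  obtain ⟨u, rfl⟩ := (InnerProductSpace.toDual ℝ V).surjective f
  simp only [InnerProductSpace.toDual_apply_apply] at hfs hs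
  have hu : u ∈ ProperCone.innerDual (K : Set V) := by
    intro v hv
    change 0 ≤ ⟪v, u⟫
    by_contra hneg
    push Not at hneg
    rw [real_inner_comm] at hneg
    have h1 := hs ((s / ⟪u, v⟫) • v)
      (subset_closure (K.smul_mem (div_pos_of_neg_of_neg hs0 hneg) hv))
    rw [inner_smul_right, div_mul_cancel₀ _ hneg.ne] at h1
    exact lt_irrefl _ h1
  have := h u hu
  rw [real_inner_comm] at this
  linarith

/-! ### Extreme subsets of the dual cone and downward directed cones -/

/-- If `E*` is an extreme set of `C*`, then `E` is downward directed for the order of `C`. Otherwise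
a linear form on pairs separates `(0, 0)` from the pairs `(a₁ - c₁ - e, a₂ - c₂ - e)`, with `cᵢ ∈ C`
and `e ∈ E`; its two components lie in `C*` and their sum lies in `E*`, so that both of them lie in
`E*` by extremality, although their values at `a₁`, `a₂` have a nonpositive sum. -/
theorem exists_common_lower_bound {C E : ConvexCone ℝ V}
    (hC : IsOpen (C : Set V)) (hCne : (C : Set V).Nonempty)
    (hE : IsOpen (E : Set V))
    (hext : IsExtreme ℝ (ProperCone.innerDual (C : Set V) : Set V)
      (ProperCone.innerDual (E : Set V) : Set V))
    {a₁ a₂ : V} (h₁ : a₁ ∈ E) (h₂ : a₂ ∈ E) :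
    ∃ e ∈ E, a₁ - e ∈ C ∧ a₂ - e ∈ C := by
  by_contra hcon
  push Not at hcon
  let S : Set (V × V) :=
    ⋃ e ∈ (E : Set V), {p | a₁ - e - p.1 ∈ (C : Set V) ∧
      a₂ - e - p.2 ∈ (C : Set V)}
  have hSmem : ∀ c₁ ∈ C, ∀ c₂ ∈ C, ∀ e ∈ E, (a₁ - e - c₁, a₂ - e - c₂) ∈ S := by
    intro c₁ hc₁ c₂ hc₂ e he
    refine mem_iUnion₂.2 ⟨e, he, ?_, ?_⟩ <;> simpa
  have hSo : IsOpen S := isOpen_biUnion fun e _ =>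
    (hC.preimage (by fun_prop)).inter (hC.preimage (by fun_prop))
  have hSc : Convex ℝ S := by
    intro p hp q hq s t hs ht hst
    obtain ⟨e, he, hp1, hp2⟩ := mem_iUnion₂.1 hp
    obtain ⟨f, hf, hq1, hq2⟩ := mem_iUnion₂.1 hq
    refine mem_iUnion₂.2 ⟨s • e + t • f, E.convex he hf hs ht hst, ?_, ?_⟩
    · convert C.convex hp1 hq1 hs ht hst using 1
      obtain rfl : s = 1 - t := by linarith
      simp only [Prod.fst_add, Prod.smul_fst]
      module
    · convert C.convex hp2 hq2 hs ht hst using 1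
      obtain rfl : s = 1 - t := by linarith
      simp only [Prod.snd_add, Prod.smul_snd]
      module
  have h0 : (0 : V × V) ∉ S := by
    intro h
    obtain ⟨e, he, h1, h2⟩ := mem_iUnion₂.1 h
    exact hcon e he (by simpa using h1) (by simpa using h2)
  obtain ⟨f, hf⟩ := geometric_hahn_banach_open_point hSc hSo h0
  obtain ⟨u₁, hu₁⟩ := (InnerProductSpace.toDual ℝ V).surjective
    (f.comp (ContinuousLinearMap.inl ℝ V V))
  obtain ⟨u₂, hu₂⟩ := (InnerProductSpace.toDual ℝ V).surjective
    (f.comp (ContinuousLinearMap.inr ℝ V V))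
  have hfu : ∀ v w : V, f (v, w) = ⟪v, u₁⟫ + ⟪w, u₂⟫ := by
    intro v w
    have e1 : f (v, 0) = ⟪v, u₁⟫ := by
      rw [real_inner_comm, ← InnerProductSpace.toDual_apply_apply, hu₁]
      simp
    have e2 : f (0, w) = ⟪w, u₂⟫ := by
      rw [real_inner_comm, ← InnerProductSpace.toDual_apply_apply, hu₂]
      simp
    rw [← e1, ← e2, ← map_add]
    simp
  have key : ∀ c₁ ∈ C, ∀ c₂ ∈ C, ∀ e ∈ E,
      ⟪a₁, u₁⟫ + ⟪a₂, u₂⟫ < ⟪c₁, u₁⟫ + ⟪c₂, u₂⟫ + ⟪e, u₁ + u₂⟫ := by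
    intro c₁ hc₁ c₂ hc₂ e he
    have := hf _ (hSmem c₁ hc₁ c₂ hc₂ e he)
    rw [hfu, map_zero] at this
    simp only [inner_sub_left] at this
    rw [inner_add_right]
    linarith
  -- Scaling `c₁`, `c₂` and `e` separately carries the inequality over to the closures of the cones,
  -- hence to limits where one or more of them vanish.
  obtain ⟨c, hc⟩ := hCne
  have scale : ∀ α β γ δ : ℝ, (∀ r s t : ℝ, 0 < r → 0 < s → 0 < t →
      α < r * β + s * γ + t * δ) → 0 ≤ β ∧ 0 ≤ γ ∧ 0 ≤ δ ∧ α ≤ 0 := by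
    intro α β γ δ h
    have lim : Tendsto (fun t : ℝ => t * β + t * γ + t * δ) (𝓝[>] 0) (𝓝 0) := by
      have : ContinuousAt (fun t : ℝ => t * β + t * γ + t * δ) 0 := by fun_prop
      simpa [ContinuousAt] using this.mono_left (nhdsWithin_le_nhds (s := Ioi (0 : ℝ)))
    have big : ∀ x y z : ℝ, (∀ r : ℝ, 0 < r → α < r * x + y + z) → 0 ≤ x := by
      intro x y z h
      by_contra hx
      push Not at hx
      have h1 := h ((|y + z - α| + 1) / (-x)) (div_pos (by positivity) (by linarith))
      have h2 : (|y + z - α| + 1) / (-x) * x = -(|y + z - α| + 1) := by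
        rw [div_mul_eq_mul_div, div_neg, mul_div_cancel_right₀ _ hx.ne]
      rw [h2] at h1
      linarith [le_abs_self (y + z - α)]
    refine ⟨big β γ δ fun r hr => ?_, big γ β δ fun r hr => ?_, big δ β γ fun r hr => ?_, ?_⟩
    · linarith [h r 1 1 hr one_pos one_pos]
    · linarith [h 1 r 1 one_pos hr one_pos]
    · linarith [h 1 1 r one_pos one_pos hr]
    · exact ge_of_tendsto lim
        (eventually_of_mem self_mem_nhdsWithin fun t ht => (h t t t ht ht ht).le)
  have hall : ∀ c₁ ∈ C, ∀ c₂ ∈ C, ∀ e ∈ E, 0 ≤ ⟪c₁, u₁⟫ ∧ 0 ≤ ⟪c₂, u₂⟫ ∧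
      0 ≤ ⟪e, u₁ + u₂⟫ ∧ ⟪a₁, u₁⟫ + ⟪a₂, u₂⟫ ≤ 0 := by
    intro c₁ hc₁ c₂ hc₂ e he
    refine scale _ _ _ _ fun r s t hr hs ht => ?_
    have := key _ (C.smul_mem hr hc₁) _ (C.smul_mem hs hc₂) _ (E.smul_mem ht he)
    simpa only [real_inner_smul_left] using this
  have hC₁ : u₁ ∈ ProperCone.innerDual (C : Set V) :=
    fun v hv => (hall v hv c hc a₁ h₁).1
  have hC₂ : u₂ ∈ ProperCone.innerDual (C : Set V) :=
    fun v hv => (hall c hc v hv a₁ h₁).2.1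
  have hEm : (2⁻¹ : ℝ) • (u₁ + u₂) ∈ ProperCone.innerDual (E : Set V) :=
    fun v hv => by
      change 0 ≤ ⟪v, (2⁻¹ : ℝ) • (u₁ + u₂)⟫
      rw [real_inner_smul_right]
      exact mul_nonneg (by norm_num) (hall c hc c hc v hv).2.2.1
  have hseg : (2⁻¹ : ℝ) • (u₁ + u₂) ∈ openSegment ℝ u₁ u₂ :=
    ⟨2⁻¹, 2⁻¹, by norm_num, by norm_num, by norm_num, (smul_add _ _ _).symm⟩
  have hE₁ := hext.left_mem_of_mem_openSegment hC₁ hC₂ hEm hseg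
  have hE₂ := hext.right_mem_of_mem_openSegment hC₁ hC₂ hEm hseg
  have hsum := (hall c hc c hc a₁ h₁).2.2.2
  have p₁ : 0 ≤ ⟪a₁, u₁⟫ := hE₁ h₁
  have p₂ : 0 ≤ ⟪a₂, u₂⟫ := hE₂ h₂
  have z₁ : u₁ = 0 := by
    by_contra hne
    linarith [inner_pos_of_mem hE hE₁ hne h₁]
  have z₂ : u₂ = 0 := by
    by_contra hne
    linarith [inner_pos_of_mem hE hE₂ hne h₂]
  have := key c hc c hc a₁ h₁
  simp [z₁, z₂] at this

theorem exists_common_lower_bound_finset {C E : ConvexCone ℝ V}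
    (hC : IsOpen (C : Set V)) (hCne : (C : Set V).Nonempty)
    (hE : IsOpen (E : Set V))
    (hext : IsExtreme ℝ (ProperCone.innerDual (C : Set V) : Set V)
      (ProperCone.innerDual (E : Set V) : Set V))
    {z : V} (hz : z ∈ E) {ι : Type*} (s : Finset ι) (a : ι → V)
    (ha : ∀ i ∈ s, a i ∈ E) : ∃ e ∈ E, ∀ i ∈ s, a i - e ∈ C := by
  classical
  induction s using Finset.induction_on with
  | empty => exact ⟨z, hz, by simp⟩
  | insert i s _ ih =>
    obtain ⟨e, he, hs⟩ := ih fun j hj => ha j (Finset.mem_insert_of_mem hj)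
    obtain ⟨e', he', h1, h2⟩ := exists_common_lower_bound hC hCne hE hext
      (ha i (Finset.mem_insert_self i s)) he
    refine ⟨e', he', fun j hj => ?_⟩
    rcases Finset.mem_insert.1 hj with rfl | hj
    · exact h1
    · have := C.add_mem (hs j hj) h2
      simpa using this

end Cones

/-! ### The gauge of an open convex cone -/

section Gauge

variable {n : ℕ}

theorem mem_dualCone {U : Set (HomSpace n)} {u : HomSpace n} :
    u ∈ dualCone U ↔ ∀ v ∈ U, 0 ≤ ⟪v, u⟫ := Iff.rfl

variable {K : ConvexCone ℝ (HomSpace n)}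

theorem exists_smul_sub_mem (hK : IsOpen (K : Set (HomSpace n))) {y : HomSpace n} (hy : y ∈ K)
    (w : HomSpace n) : ∃ c : ℝ, 0 < c ∧ c • y - w ∈ K := by
  have hc : ContinuousAt (fun t : ℝ => y - t • w) 0 := by fun_prop
  have h1 : ∀ᶠ t : ℝ in 𝓝 0, y - t • w ∈ (K : Set (HomSpace n)) :=
    hc.eventually_mem (hK.mem_nhds (by simpa using hy))
  obtain ⟨t, ht, ht0⟩ := ((h1.filter_mono nhdsWithin_le_nhds).and
    (self_mem_nhdsWithin : Ioi (0 : ℝ) ∈ 𝓝[>] 0)).exists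
  have ht0 : 0 < t := ht0
  refine ⟨t⁻¹, inv_pos.2 ht0, ?_⟩
  have := K.smul_mem (inv_pos.2 ht0) ht
  rwa [smul_sub, smul_smul, inv_mul_cancel₀ ht0.ne', one_smul] at this

theorem gaugeM_nonneg (U : Set (HomSpace n)) (w y : HomSpace n) : 0 ≤ gaugeM U w y :=
  Real.sInf_nonneg fun _ hc => hc.1.le

theorem gaugeM_smul_sub_mem (hK : IsOpen (K : Set (HomSpace n))) {y : HomSpace n} (hy : y ∈ K)
    (w : HomSpace n) :
    gaugeM (K : Set (HomSpace n)) w y • y - w ∈ closure (K : Set (HomSpace n)) := by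
  obtain ⟨c, hc, hcy⟩ := exists_smul_sub_mem hK hy w
  have hne : {c : ℝ | 0 < c ∧ c • y - w ∈ closure (K : Set (HomSpace n))}.Nonempty :=
    ⟨c, hc, subset_closure hcy⟩
  have h1 := csInf_mem_closure hne ⟨0, fun _ hc => hc.1.le⟩
  have h2 : IsClosed {c : ℝ | c • y - w ∈ closure (K : Set (HomSpace n))} :=
    isClosed_closure.preimage (by fun_prop)
  exact closure_minimal (fun c hc => hc.2) h2 h1

/-- The infimum defining the gauge is a minimum, and the bound `0 < c` may be relaxed. -/
theorem gaugeM_le_iff (hK : IsOpen (K : Set (HomSpace n))) {y : HomSpace n} (hy : y ∈ K)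
    {w : HomSpace n} {c : ℝ} (hc : 0 ≤ c) :
    gaugeM (K : Set (HomSpace n)) w y ≤ c ↔ c • y - w ∈ closure (K : Set (HomSpace n)) := by
  have up : ∀ {a b : ℝ}, a ≤ b → a • y - w ∈ closure (K : Set (HomSpace n)) →
      b • y - w ∈ closure (K : Set (HomSpace n)) := by
    intro a b hab ha
    rcases hab.eq_or_lt with rfl | hab
    · exact ha
    · have := add_mem_closure_cone K ha (subset_closure (K.smul_mem (sub_pos.2 hab) hy))
      convert this using 1
      rw [sub_smul]
      abel
  constructor
  · intro h
    exact up h (gaugeM_smul_sub_mem hK hy w)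
  · intro h
    refine le_of_forall_pos_le_add fun ε hε => ?_
    exact csInf_le ⟨0, fun _ hc => hc.1.le⟩ ⟨by positivity, up (by linarith) h⟩

theorem gaugeM_le_iff_dual (hK : IsOpen (K : Set (HomSpace n))) {y : HomSpace n} (hy : y ∈ K)
    {w : HomSpace n} {c : ℝ} (hc : 0 ≤ c) :
    gaugeM (K : Set (HomSpace n)) w y ≤ c ↔
      ∀ u ∈ dualCone (K : Set (HomSpace n)), ⟪w, u⟫ ≤ c * ⟪y, u⟫ := by
  have key : ∀ u : HomSpace n, ⟪c • y - w, u⟫ = c * ⟪y, u⟫ - ⟪w, u⟫ := fun u => by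
    rw [inner_sub_left, real_inner_smul_left]
  rw [gaugeM_le_iff hK hy hc]
  constructor
  · intro h u hu
    have := inner_nonneg_of_mem_closure hu h
    rw [key] at this
    linarith
  · intro h
    refine mem_closure_cone_of_forall_dual hy fun u hu => ?_
    rw [key]
    linarith [h u hu]

theorem inner_le_gaugeM_mul (hK : IsOpen (K : Set (HomSpace n))) {y : HomSpace n} (hy : y ∈ K)
    (w : HomSpace n) {u : HomSpace n} (hu : u ∈ dualCone (K : Set (HomSpace n))) :
    ⟪w, u⟫ ≤ gaugeM (K : Set (HomSpace n)) w y * ⟪y, u⟫ :=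
  (gaugeM_le_iff_dual hK hy (gaugeM_nonneg _ _ _)).1 le_rfl u hu

theorem gaugeM_triangle (hK : IsOpen (K : Set (HomSpace n))) {y v : HomSpace n} (hy : y ∈ K)
    (hv : v ∈ K) (w : HomSpace n) :
    gaugeM (K : Set (HomSpace n)) w v ≤
      gaugeM (K : Set (HomSpace n)) w y * gaugeM (K : Set (HomSpace n)) y v := by
  have h0 := gaugeM_nonneg (K : Set (HomSpace n)) w y
  refine (gaugeM_le_iff_dual hK hv (mul_nonneg h0 (gaugeM_nonneg _ _ _))).2 fun u hu => ?_
  calc ⟪w, u⟫ ≤ _ := inner_le_gaugeM_mul hK hy w hu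
    _ ≤ _ := mul_le_mul_of_nonneg_left (inner_le_gaugeM_mul hK hv y hu) h0
    _ = _ := by ring

theorem gaugeM_add_le (hK : IsOpen (K : Set (HomSpace n))) {y : HomSpace n} (hy : y ∈ K)
    (v w : HomSpace n) :
    gaugeM (K : Set (HomSpace n)) (v + w) y ≤
      gaugeM (K : Set (HomSpace n)) v y + gaugeM (K : Set (HomSpace n)) w y := by
  refine (gaugeM_le_iff_dual hK hy
    (add_nonneg (gaugeM_nonneg _ _ _) (gaugeM_nonneg _ _ _))).2 fun u hu => ?_
  rw [inner_add_left, add_mul]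
  exact add_le_add (inner_le_gaugeM_mul hK hy v hu) (inner_le_gaugeM_mul hK hy w hu)

theorem gaugeM_mono (hK : IsOpen (K : Set (HomSpace n))) {y v w : HomSpace n} (hy : y ∈ K)
    (h : w - v ∈ closure (K : Set (HomSpace n))) :
    gaugeM (K : Set (HomSpace n)) v y ≤ gaugeM (K : Set (HomSpace n)) w y := by
  refine (gaugeM_le_iff hK hy (gaugeM_nonneg _ _ _)).2 ?_
  have := add_mem_closure_cone K (gaugeM_smul_sub_mem hK hy w) h
  simpa using this

theorem gaugeM_smul_left (hK : IsOpen (K : Set (HomSpace n))) {y : HomSpace n} (hy : y ∈ K)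
    (w : HomSpace n) {c : ℝ} (hc : 0 < c) :
    gaugeM (K : Set (HomSpace n)) (c • w) y = c * gaugeM (K : Set (HomSpace n)) w y := by
  have h : ∀ (w : HomSpace n) {c : ℝ}, 0 < c →
      gaugeM (K : Set (HomSpace n)) (c • w) y ≤ c * gaugeM (K : Set (HomSpace n)) w y := by
    intro w c hc
    refine (gaugeM_le_iff hK hy (mul_nonneg hc.le (gaugeM_nonneg _ _ _))).2 ?_
    have := smul_mem_closure_cone K hc (gaugeM_smul_sub_mem hK hy w)
    rwa [smul_sub, smul_smul] at this
  refine le_antisymm (h w hc) ?_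
  have := h (c • w) (inv_pos.2 hc)
  rw [smul_smul, inv_mul_cancel₀ hc.ne', one_smul] at this
  rwa [← le_inv_mul_iff₀ hc]

theorem gaugeM_smul_right (hK : IsOpen (K : Set (HomSpace n))) {y : HomSpace n} (hy : y ∈ K)
    (w : HomSpace n) {c : ℝ} (hc : 0 < c) :
    gaugeM (K : Set (HomSpace n)) w (c • y) = gaugeM (K : Set (HomSpace n)) w y / c := by
  refine eq_of_forall_ge_iff fun a => ?_
  rcases le_or_gt 0 a with ha | ha
  · rw [gaugeM_le_iff hK (K.smul_mem hc hy) ha, smul_smul,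
      ← gaugeM_le_iff hK hy (mul_nonneg ha hc.le), div_le_iff₀ hc]
  · exact iff_of_false (by linarith [gaugeM_nonneg (K : Set (HomSpace n)) w (c • y)])
      (by linarith [div_nonneg (gaugeM_nonneg (K : Set (HomSpace n)) w y) hc.le])

theorem gaugeM_pos_of_inner_pos (hK : IsOpen (K : Set (HomSpace n))) {y w u : HomSpace n}
    (hy : y ∈ K) (hu : u ∈ dualCone (K : Set (HomSpace n))) (hw : 0 < ⟪w, u⟫) :
    0 < gaugeM (K : Set (HomSpace n)) w y := by
  refine (gaugeM_nonneg _ _ _).lt_of_ne fun h => ?_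
  have := inner_le_gaugeM_mul hK hy w hu
  rw [← h, zero_mul] at this
  linarith

end Gauge

/-! ### The Legendre–Fenchel transform as a quotient of gauges -/

section Transform

variable {n : ℕ} {K : ConvexCone ℝ (HomSpace n)}

theorem legendreFenchel_charI_zeroSet (hK : IsOpen (K : Set (HomSpace n))) {b z w : HomSpace n}
    (hz : z ∈ K) (hb : 0 < gaugeM (K : Set (HomSpace n)) b z) :
    legendreFenchel (charI (zeroSet b (K : Set (HomSpace n)) z)) w =
      ((gaugeM (K : Set (HomSpace n)) w z / gaugeM (K : Set (HomSpace n)) b z : ℝ) : EReal) := by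
  have hval : ∀ u ∈ zeroSet b (K : Set (HomSpace n)) z,
      ((⟪w, u⟫ : ℝ) : EReal) ≤ legendreFenchel (charI (zeroSet b (K : Set (HomSpace n)) z)) w := by
    intro u hu
    have := le_iSup (fun v : HomSpace n =>
      ((⟪w, v⟫ : ℝ) : EReal) - charI (zeroSet b (K : Set (HomSpace n)) z) v) u
    rw [charI, if_pos hu, sub_zero] at this
    exact this
  refine le_antisymm (iSup_le fun u => ?_) (le_of_not_gt fun hlt => ?_)
  · by_cases hu : u ∈ zeroSet b (K : Set (HomSpace n)) z
    · simp only [charI, if_pos hu, sub_zero, EReal.coe_le_coe_iff]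
      have h2 := hu.2
      simp only [mem_ofPred_eq] at h2
      rw [real_inner_comm] at h2
      rw [le_div_iff₀ hb]
      calc ⟪w, u⟫ * gaugeM (K : Set (HomSpace n)) b z
          ≤ gaugeM (K : Set (HomSpace n)) w z * ⟪z, u⟫ * gaugeM (K : Set (HomSpace n)) b z :=
            mul_le_mul_of_nonneg_right (inner_le_gaugeM_mul hK hz w hu.1) hb.le
        _ = gaugeM (K : Set (HomSpace n)) w z * (gaugeM (K : Set (HomSpace n)) b z * ⟪z, u⟫) := by
            ring
        _ ≤ gaugeM (K : Set (HomSpace n)) w z * 1 :=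
            mul_le_mul_of_nonneg_left h2 (gaugeM_nonneg _ _ _)
        _ = _ := mul_one _
    · simp [charI, if_neg hu]
  · obtain ⟨s, hs1, hs2⟩ := EReal.lt_iff_exists_real_btwn.1 hlt
    rw [EReal.coe_lt_coe_iff] at hs2
    have hle : ∀ u ∈ zeroSet b (K : Set (HomSpace n)) z, ⟪w, u⟫ ≤ s := fun u hu =>
      EReal.coe_le_coe_iff.1 ((hval u hu).trans hs1.le)
    have h0 : (0 : HomSpace n) ∈ zeroSet b (K : Set (HomSpace n)) z :=
      ⟨mem_dualCone.2 fun v _ => by simp, by simp⟩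
    have hs0 : 0 ≤ s := by simpa using hle 0 h0
    refine absurd hs2 (not_lt.2 ?_)
    rw [div_le_iff₀ hb]
    refine (gaugeM_le_iff_dual hK hz (mul_nonneg hs0 hb.le)).2 fun u hu => ?_
    rcases eq_or_ne u 0 with rfl | hu0
    · simp
    have hzu : 0 < ⟪z, u⟫ := inner_pos_of_mem hK hu hu0 hz
    have hpos : 0 < gaugeM (K : Set (HomSpace n)) b z * ⟪z, u⟫ := mul_pos hb hzu
    -- Normalised so that the constraint defining the set is an equality.
    have hmem : (gaugeM (K : Set (HomSpace n)) b z * ⟪z, u⟫)⁻¹ • u ∈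
        zeroSet b (K : Set (HomSpace n)) z := by
      refine ⟨mem_dualCone.2 fun v hv => ?_, ?_⟩
      · rw [real_inner_smul_right]
        exact mul_nonneg (inv_pos.2 hpos).le (mem_dualCone.1 hu v hv)
      · simp only [mem_ofPred_eq]
        rw [real_inner_smul_left, real_inner_comm z u, mul_left_comm, inv_mul_cancel₀ hpos.ne']
    have h1 := hle _ hmem
    rw [real_inner_smul_right, inv_mul_le_iff₀ hpos] at h1
    linarith

theorem funkBusemann_eq (hK : IsOpen (K : Set (HomSpace n)))
    {D : Set (EuclideanSpace ℝ (Fin n))} {b : EuclideanSpace ℝ (Fin n)} {z : HomSpace n}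
    (hz : z ∈ K) (hb : 0 < gaugeM (K : Set (HomSpace n)) (homLift b) z) (p : D) :
    funkBusemann D b (K : Set (HomSpace n)) z p =
      Real.log (gaugeM (K : Set (HomSpace n)) (homLift (p : EuclideanSpace ℝ (Fin n))) z /
        gaugeM (K : Set (HomSpace n)) (homLift b) z) := by
  rw [funkBusemann, legendreFenchel_charI_zeroSet hK hz hb, EReal.toReal_coe]

end Transform

/-! ### The cone over a bounded open convex set -/

section Projective

variable {n : ℕ} {D : Set (EuclideanSpace ℝ (Fin n))}

@[simp] theorem homLift_fst (p : EuclideanSpace ℝ (Fin n)) : (homLift p).fst = p := rfl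

@[simp] theorem homLift_snd (p : EuclideanSpace ℝ (Fin n)) : (homLift p).snd = 1 := rfl

theorem HomSpace.ext_fst_snd {v w : HomSpace n} (h1 : v.fst = w.fst) (h2 : v.snd = w.snd) :
    v = w := by
  apply (WithLp.equiv 2 _).injective
  exact Prod.ext h1 h2

theorem continuous_homSpace_fst : Continuous fun v : HomSpace n => v.fst :=
  (WithLp.fstL 2 ℝ (EuclideanSpace ℝ (Fin n)) ℝ).continuous

theorem continuous_homSpace_snd : Continuous fun v : HomSpace n => v.snd :=
  (WithLp.sndL 2 ℝ (EuclideanSpace ℝ (Fin n)) ℝ).continuous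

theorem continuous_homLift : Continuous (homLift : EuclideanSpace ℝ (Fin n) → HomSpace n) :=
  (WithLp.prod_continuous_toLp 2 _ _).comp (by fun_prop)

theorem snd_smul_homLift {v : HomSpace n} (hv : 0 < v.snd) :
    v.snd • homLift (v.snd⁻¹ • v.fst) = v :=
  HomSpace.ext_fst_snd (by simp [smul_smul, hv.ne']) (by simp)

theorem mem_coneOver_iff {v : HomSpace n} :
    v ∈ coneOver D ↔ 0 < v.snd ∧ v.snd⁻¹ • v.fst ∈ D := by
  constructor
  · rintro ⟨p, hp, c, hc, rfl⟩
    simpa [smul_smul, hc.ne', hc] using hp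
  · rintro ⟨h, hD⟩
    exact ⟨_, hD, _, h, (snd_smul_homLift h).symm⟩

theorem homLift_mem_coneOver {p : EuclideanSpace ℝ (Fin n)} (hp : p ∈ D) :
    homLift p ∈ coneOver D := ⟨p, hp, 1, one_pos, (one_smul _ _).symm⟩

/-- The cone over a convex set, as a convex cone. -/
def homCone (hD : Convex ℝ D) : ConvexCone ℝ (HomSpace n) where
  carrier := coneOver D
  smul_mem' := by
    rintro c hc _ ⟨p, hp, a, ha, rfl⟩
    exact ⟨p, hp, c * a, mul_pos hc ha, smul_smul _ _ _⟩
  add_mem' := by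
    intro v hv w hw
    rw [mem_coneOver_iff] at hv hw ⊢
    obtain ⟨hv0, hvD⟩ := hv
    obtain ⟨hw0, hwD⟩ := hw
    have hs : 0 < v.snd + w.snd := add_pos hv0 hw0
    refine ⟨hs, ?_⟩
    convert hD hvD hwD (div_pos hv0 hs).le (div_pos hw0 hs).le
      (by rw [← add_div, div_self hs.ne']) using 1
    simp only [WithLp.add_fst, WithLp.add_snd, smul_smul, smul_add]
    congr 2 <;> field_simp

theorem coe_homCone (hD : Convex ℝ D) : (homCone hD : Set (HomSpace n)) = coneOver D := rfl

theorem continuousAt_snd_inv_smul_fst {v : HomSpace n} (hv : 0 < v.snd) :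
    ContinuousAt (fun w : HomSpace n => w.snd⁻¹ • w.fst) v :=
  (continuous_homSpace_snd.continuousAt.inv₀ hv.ne').smul continuous_homSpace_fst.continuousAt

theorem isOpen_coneOver (hD : IsOpen D) : IsOpen (coneOver D) := by
  rw [isOpen_iff_mem_nhds]
  intro v hv
  obtain ⟨hv0, hvD⟩ := mem_coneOver_iff.1 hv
  filter_upwards [continuous_homSpace_snd.continuousAt.eventually_mem (Ioi_mem_nhds hv0),
    (continuousAt_snd_inv_smul_fst hv0).eventually_mem (hD.mem_nhds hvD)] with w h1 h2
  exact mem_coneOver_iff.2 ⟨h1, h2⟩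

theorem snd_nonneg_of_mem_closure_coneOver {v : HomSpace n} (hv : v ∈ closure (coneOver D)) :
    0 ≤ v.snd :=
  closure_minimal (t := {v : HomSpace n | 0 ≤ v.snd}) (fun _ hw => (mem_coneOver_iff.1 hw).1.le)
    (isClosed_le continuous_const continuous_homSpace_snd) hv

theorem homLift_mem_closure_coneOver {p : EuclideanSpace ℝ (Fin n)} (hp : p ∈ closure D) :
    homLift p ∈ closure (coneOver D) :=
  map_mem_closure continuous_homLift hp fun _ hq => homLift_mem_coneOver hq

theorem snd_inv_smul_fst_mem_closure {v : HomSpace n} (hv : v ∈ closure (coneOver D))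
    (hv0 : 0 < v.snd) : v.snd⁻¹ • v.fst ∈ closure D := by
  rw [mem_closure_iff_nhds] at hv ⊢
  intro t ht
  obtain ⟨w, hwt, hwC⟩ := hv _ ((continuousAt_snd_inv_smul_fst hv0).preimage_mem_nhds ht)
  exact ⟨_, hwt, (mem_coneOver_iff.1 hwC).2⟩

/-! ### The metrics as logarithms of gauges -/

theorem one_le_gaugeM_homLift (hDo : IsOpen D) (hDc : Convex ℝ D)
    {p : EuclideanSpace ℝ (Fin n)} (hp : p ∈ D) (x : EuclideanSpace ℝ (Fin n)) :
    1 ≤ gaugeM (coneOver D) (homLift x) (homLift p) := by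
  have h := snd_nonneg_of_mem_closure_coneOver (gaugeM_smul_sub_mem (K := homCone hDc)
    (isOpen_coneOver hDo) (homLift_mem_coneOver hp) (homLift x))
  simpa [coe_homCone] using h

theorem gaugeM_homLift_self (hDo : IsOpen D) (hDc : Convex ℝ D)
    {p : EuclideanSpace ℝ (Fin n)} (hp : p ∈ D) :
    gaugeM (coneOver D) (homLift p) (homLift p) = 1 := by
  refine le_antisymm ?_ (one_le_gaugeM_homLift hDo hDc hp p)
  refine (gaugeM_le_iff (K := homCone hDc) (isOpen_coneOver hDo)
    (homLift_mem_coneOver hp) zero_le_one).2 ?_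
  rw [one_smul, sub_self]
  exact zero_mem_closure_cone (homCone hDc) (homLift_mem_coneOver hp)

/-- The cross ratio of the reverse-Funk metric is a gauge: `c • (p, 1) - (y, 1)` is a positive
multiple of the lift of the point with parameter `c / (c - 1)` on the line from `y` through `p`, so
that the least admissible `c` corresponds to the point where this line leaves `D`. -/
theorem dist_exitPoint_div (hDo : IsOpen D) (hDc : Convex ℝ D) (hDb : Bornology.IsBounded D)
    {p y : EuclideanSpace ℝ (Fin n)} (hp : p ∈ D) (hne : y ≠ p) :
    dist (exitPoint D y p) y / dist (exitPoint D y p) p =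
      gaugeM (coneOver D) (homLift y) (homLift p) := by
  set S : Set ℝ := {t : ℝ | AffineMap.lineMap y p t ∈ D} with hS
  set τ : ℝ := sSup S with hτ
  have hd : 0 < dist y p := dist_pos.2 hne
  have hcont : Continuous fun t : ℝ => (AffineMap.lineMap y p t : EuclideanSpace ℝ (Fin n)) :=
    AffineMap.lineMap_continuous
  have h1S : (1 : ℝ) ∈ S := by simpa [hS] using hp
  have hSb : BddAbove S := by
    obtain ⟨R, hR⟩ := hDb.closure.subset_closedBall y
    refine ⟨R / dist y p, fun t ht => ?_⟩
    have := hR (subset_closure ht)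
    rw [Metric.mem_closedBall, dist_lineMap_left] at this
    rw [le_div_iff₀ hd]
    exact (mul_le_mul_of_nonneg_right (le_abs_self t) hd.le).trans this
  have hSo : IsOpen S := hDo.preimage hcont
  have hτ1 : 1 < τ := by
    obtain ⟨ε, hε, hball⟩ := Metric.isOpen_iff.1 hSo 1 h1S
    have : (1 + ε / 2 : ℝ) ∈ S := hball (by
      rw [Metric.mem_ball, Real.dist_eq, add_sub_cancel_left, abs_of_pos (by linarith)]
      linarith)
    linarith [le_csSup hSb this]
  have hτcl : (AffineMap.lineMap y p τ : EuclideanSpace ℝ (Fin n)) ∈ closure D :=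
    map_mem_closure hcont (csSup_mem_closure ⟨1, h1S⟩ hSb) fun t ht => ht
  have hlhs : dist (exitPoint D y p) y / dist (exitPoint D y p) p = τ / (τ - 1) := by
    rw [exitPoint, dist_lineMap_left, dist_lineMap_right, mul_div_mul_right _ _ hd.ne',
      Real.norm_eq_abs, Real.norm_eq_abs, abs_of_pos (by linarith), abs_sub_comm,
      abs_of_pos (by linarith)]
  have hiff := fun {c : ℝ} (hc : 0 ≤ c) => gaugeM_le_iff (K := homCone hDc) (isOpen_coneOver hDo)
    (homLift_mem_coneOver hp) (w := homLift y) hc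
  rw [coe_homCone] at hiff
  have hpt : ∀ t : ℝ, 1 < t → (t / (t - 1)) • homLift p - homLift y =
      (1 / (t - 1)) • homLift (AffineMap.lineMap y p t : EuclideanSpace ℝ (Fin n)) := by
    intro t ht
    have ht' : t - 1 ≠ 0 := by linarith
    refine HomSpace.ext_fst_snd ?_ ?_
    · simp only [WithLp.sub_fst, WithLp.smul_fst, homLift_fst, AffineMap.lineMap_apply_module',
        smul_add, smul_smul, smul_sub]
      match_scalars <;> field_simp
      ring
    · simp only [WithLp.sub_snd, WithLp.smul_snd, homLift_snd, smul_eq_mul]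
      field_simp
      ring
  rw [hlhs]
  refine le_antisymm (le_of_not_gt fun hlt => ?_) ?_
  · -- A smaller gauge would give a point of `closure D` beyond the exit point.
    obtain ⟨c, hc1, hc2⟩ := exists_between hlt
    have hg1 := one_le_gaugeM_homLift hDo hDc hp y
    have hcone : 1 < c := hg1.trans_lt hc1
    have hτ' : 0 < τ - 1 := by linarith
    have ht1 : 1 < c / (c - 1) := by
      rw [lt_div_iff₀ (by linarith)]
      linarith
    have hτt : τ < c / (c - 1) := by
      rw [lt_div_iff₀ hτ'] at hc2
      rw [lt_div_iff₀ (by linarith)]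
      linarith
    have hback : c / (c - 1) / (c / (c - 1) - 1) = c := by
      have : c - 1 ≠ 0 := by linarith
      field_simp
      ring
    have hmem := (hiff (by linarith)).1 hc1.le
    rw [← hback, hpt _ ht1] at hmem
    have hpos : 0 < 1 / (c / (c - 1) - 1) := one_div_pos.2 (by linarith)
    have hcl := snd_inv_smul_fst_mem_closure hmem (by simpa using hpos)
    simp only [WithLp.smul_snd, WithLp.smul_fst, homLift_fst, homLift_snd, smul_eq_mul, mul_one,
      smul_smul, inv_mul_cancel₀ hpos.ne', one_smul] at hcl
    set t := c / (c - 1) with ht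
    obtain ⟨s, hs1, hs2⟩ := exists_between hτt
    have hseg : (AffineMap.lineMap y p s : EuclideanSpace ℝ (Fin n)) ∈ interior D := by
      refine hDc.openSegment_interior_closure_subset_interior
        (by rwa [hDo.interior_eq]) hcl ⟨(t - s) / (t - 1), (s - 1) / (t - 1), ?_, ?_, ?_, ?_⟩
      · exact div_pos (by linarith) (by linarith)
      · exact div_pos (by linarith) (by linarith)
      · have : t - 1 ≠ 0 := by linarith
        field_simp
        ring
      · have : t - 1 ≠ 0 := by linarith
        simp only [AffineMap.lineMap_apply_module', smul_add, smul_sub, smul_smul]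
        match_scalars <;> field_simp <;> ring
    have := le_csSup hSb (show s ∈ S from interior_subset (s := D) hseg)
    linarith
  · refine (hiff (div_nonneg (by linarith) (by linarith))).2 ?_
    rw [hpt τ hτ1]
    exact smul_mem_closure_cone (homCone hDc) (one_div_pos.2 (by linarith))
      (homLift_mem_closure_coneOver hτcl)

theorem revFunkDist_eq (hDo : IsOpen D) (hDc : Convex ℝ D) (hDb : Bornology.IsBounded D)
    {p y : EuclideanSpace ℝ (Fin n)} (hp : p ∈ D) :
    revFunkDist D p y = Real.log (gaugeM (coneOver D) (homLift y) (homLift p)) := by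
  rw [revFunkDist]
  split_ifs with h
  · rw [← h, gaugeM_homLift_self hDo hDc hp, Real.log_one]
  · rw [dist_exitPoint_div hDo hDc hDb hp (Ne.symm h)]

theorem hilbertDist_eq (hDo : IsOpen D) (hDc : Convex ℝ D) (hDb : Bornology.IsBounded D)
    {p q : EuclideanSpace ℝ (Fin n)} (hp : p ∈ D) (hq : q ∈ D) :
    hilbertDist D p q = Real.log (gaugeM (coneOver D) (homLift p) (homLift q)) +
      Real.log (gaugeM (coneOver D) (homLift q) (homLift p)) := by
  have h1 := one_le_gaugeM_homLift hDo hDc hp q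
  have h2 := one_le_gaugeM_homLift hDo hDc hq p
  rw [hilbertDist]
  split_ifs with h
  · rw [← h, gaugeM_homLift_self hDo hDc hp]
    simp
  · rw [dist_exitPoint_div hDo hDc hDb hp (Ne.symm h),
      dist_exitPoint_div hDo hDc hDb hq h,
      Real.log_mul (by linarith) (by linarith)]

end Projective

/-! ### Busemann points and minimising sequences -/

section Busemann

variable {X : Type*} {d : X → X → ℝ} {b : X} {h : X → ℝ}

theorem tendsto_toUnif_iff {ι : Type*} {l : Filter ι} {F : ι → X → ℝ} :
    Tendsto (fun i => toUnif d (F i)) l (𝓝 (toUnif d h)) ↔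
      ∀ B ∈ symBoundedSets d, TendstoUniformlyOn F h l B :=
  UniformOnFun.tendsto_iff_tendstoUniformlyOn

theorem tendsto_apply_of_tendsto_toUnif {ι : Type*} {l : Filter ι} {F : ι → X → ℝ}
    (hF : Tendsto (fun i => toUnif d (F i)) l (𝓝 (toUnif d h))) (p : X) :
    Tendsto (fun i => F i p) l (𝓝 (h p)) :=
  (tendsto_toUnif_iff.1 hF {p} ⟨d p p + d p p, by simp⟩).tendsto_at (mem_singleton p)

/-- A limit `h` of functions `ψ_{y k}` along a sequence that goes to infinity and asymptotically
attains the lower bound `h ≥ -d(b, ·)` is a Busemann point: a rapidly increasing subsequence,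
parametrised by the distance from `b`, is an almost-geodesic. -/
theorem isBusemannPoint_of_seq (hself : ∀ p, d p p = 0) (hnn : ∀ p q, 0 ≤ d p q)
    (htri : ∀ p q r, d p r ≤ d p q + d q r) (y : ℕ → X)
    (hlim : Tendsto (fun k => toUnif d (distFn d b (y k))) atTop (𝓝 (toUnif d h)))
    (hinf : Tendsto (fun k => d b (y k)) atTop atTop)
    (hmin : ∀ ε > 0, ∀ᶠ k in atTop, d b (y k) + h (y k) < ε) : IsBusemannPoint d b h := by
  have hpt := tendsto_apply_of_tendsto_toUnif hlim
  refine ⟨⟨mem_closure_of_tendsto hlim (Eventually.of_forall fun k => ⟨y k, rfl⟩), ?_⟩, ?_⟩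
  · rintro ⟨q, rfl⟩
    obtain ⟨k, hk1, hk2⟩ :=
      ((hmin 1 one_pos).and (hinf.eventually_gt_atTop (1 + d b q))).exists
    simp only [distFn] at hk1
    linarith [hnn (y k) q]
  obtain ⟨φ, hφ0, hφ⟩ := exists_seq_of_forall_finset_exists (fun j : ℕ => 0 < d b (y j))
    (fun i j => i < j ∧ d b (y i) < d b (y j) ∧
      distFn d b (y j) (y i) < h (y i) + 1 / ((i : ℝ) + 1)) (by
    intro s _
    have h1 : ∀ i ∈ s, ∀ᶠ j in atTop, i < j ∧ d b (y i) < d b (y j) ∧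
        distFn d b (y j) (y i) < h (y i) + 1 / ((i : ℝ) + 1) := fun i _ =>
      (eventually_gt_atTop i).and ((hinf.eventually_gt_atTop _).and
        ((hpt (y i)).eventually_lt_const (by linarith [Nat.one_div_pos_of_nat (α := ℝ) (n := i)])))
    exact ((hinf.eventually_gt_atTop 0).and ((Finset.eventually_all s).2 h1)).exists)
  have hφm : StrictMono φ := fun i j hij => (hφ i j hij).1
  set a : ℕ → ℝ := fun j => d b (y (φ j)) with ha
  have ham : StrictMono a := fun i j hij => (hφ i j hij).2.1
  have hext : ∀ j, Function.extend a (y ∘ φ) (fun _ => b) (a j) = y (φ j) := fun j =>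
    ham.injective.extend_apply _ _ j
  have hγ0 : Function.extend a (y ∘ φ) (fun _ => b) 0 = b :=
    Function.extend_apply' _ _ _ (by rintro ⟨j, hj⟩; exact (hφ0 j).ne' hj)
  have hcase : ∀ i, ∀ t ∈ insert 0 (range a), a i ≤ t → ∃ j, i ≤ j ∧ a j = t := by
    rintro i t (rfl | ⟨j, rfl⟩) hit
    · exact absurd hit (not_le.2 (hφ0 i))
    · exact ⟨j, ham.le_iff_le.1 hit, rfl⟩
  refine ⟨insert 0 (range a), Function.extend a (y ∘ φ) (fun _ => b), ⟨?_, ?_, ?_, ?_⟩, ?_⟩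
  · rintro _ (rfl | ⟨j, rfl⟩)
    · exact mem_Ici.2 le_rfl
    · exact (hφ0 j).le
  · exact mem_insert _ _
  · rintro ⟨m, hm, hmax⟩
    rcases hm with rfl | ⟨j, rfl⟩
    · exact absurd (hmax (mem_insert_of_mem _ ⟨0, rfl⟩)) (not_le.2 (hφ0 0))
    · exact absurd (hmax (mem_insert_of_mem _ ⟨j + 1, rfl⟩)) (not_le.2 (ham j.lt_succ_self))
  · intro ε hε
    obtain ⟨i, hi1, hi2⟩ := ((hφm.tendsto_atTop.eventually (eventually_forall_ge_atTop.2
      (hmin (ε / 2) (half_pos hε)))).and (hφm.tendsto_atTop.eventually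
      (eventually_forall_ge_atTop.2 (tendsto_one_div_add_atTop_nhds_zero_nat.eventually_lt_const
        (half_pos hε))))).exists
    refine ⟨a i, mem_insert_of_mem _ ⟨i, rfl⟩, fun s hs t ht his hst => ?_⟩
    obtain ⟨j, hij, rfl⟩ := hcase i s hs his
    obtain ⟨k, hjk, rfl⟩ := hcase j t ht hst
    rw [hγ0, hext, hext]
    have hlow := htri b (y (φ j)) (y (φ k))
    rw [abs_of_nonneg (by simp only [ha]; linarith)]
    rcases hjk.eq_or_lt with rfl | hlt
    · simpa [ha, hself] using hε
    · have e1 := (hφ j k hlt).2.2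
      have e2 := hi1 (φ j) (hφm.monotone hij)
      have e3 := hi2 (φ j) (hφm.monotone hij)
      simp only [distFn] at e1
      simp only [ha]
      linarith
  · intro U hU
    obtain ⟨i, hi⟩ := eventually_atTop.1 ((hlim.comp hφm.tendsto_atTop).eventually_mem hU)
    refine mem_map.2 (mem_atTop_sets.2 ⟨⟨a i, mem_insert_of_mem _ ⟨i, rfl⟩⟩, ?_⟩)
    rintro ⟨t, ht⟩ hit
    obtain ⟨j, hij, rfl⟩ := hcase i t ht hit
    rw [mem_preimage, hext]
    exact hi j hij

/-- Along an almost-geodesic that converges to it, a Busemann point is close to its lower bound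
`-d(b, ·)`. -/
theorem IsAlmostGeodesic.eventually_le (hself : ∀ p, d p p = 0) {T : Set ℝ} {γ : ℝ → X}
    (hγ : IsAlmostGeodesic d T γ)
    (hlim : Tendsto (fun t : T => toUnif d (distFn d b (γ t))) atTop (𝓝 (toUnif d h))) :
    ∀ᶠ t : T in atTop, d b (γ t) + h (γ t) ≤ 1 := by
  have hpt := tendsto_apply_of_tendsto_toUnif hlim
  obtain ⟨-, h0, -, hgeo⟩ := hγ
  have : Nonempty T := ⟨⟨0, h0⟩⟩
  obtain ⟨N, hN, hNT⟩ := hgeo (1 / 4) (by norm_num)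
  filter_upwards [eventually_ge_atTop (⟨N, hN⟩ : T),
    (hpt (γ 0)).eventually_const_lt (show h (γ 0) - 1 / 4 < h (γ 0) by linarith)] with s hs hs0
  have hlim' : Tendsto (fun t : T => d (γ 0) (γ s) + distFn d b (γ t) (γ s)
      - distFn d b (γ t) (γ 0)) atTop (𝓝 (d (γ 0) (γ s) + h (γ s) - h (γ 0))) :=
    ((hpt (γ s)).const_add _).sub (hpt (γ 0))
  have hle : d (γ 0) (γ s) + h (γ s) - h (γ 0) ≤ 1 / 2 := by
    refine le_of_tendsto hlim' ((eventually_ge_atTop s).mono fun t hst => ?_)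
    have e1 := (abs_lt.1 (hNT s s.2 t t.2 hs hst)).2
    have e2 := (abs_lt.1 (hNT t t.2 t t.2 (le_trans hs hst) le_rfl)).1
    rw [hself] at e2
    simp only [distFn]
    linarith
  simp only [distFn] at hs0
  linarith

end Busemann

/-! ### The Hilbert metric on a bounded open convex set -/

section HilbertMetric

variable {n : ℕ} {D : Set (EuclideanSpace ℝ (Fin n))}

theorem hilbertDist_self (p : EuclideanSpace ℝ (Fin n)) : hilbertDist D p p = 0 := by
  simp [hilbertDist]

theorem log_gaugeM_homLift_nonneg (hDo : IsOpen D) (hDc : Convex ℝ D)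
    {q : EuclideanSpace ℝ (Fin n)} (hq : q ∈ D) (p : EuclideanSpace ℝ (Fin n)) :
    0 ≤ Real.log (gaugeM (coneOver D) (homLift p) (homLift q)) :=
  Real.log_nonneg (one_le_gaugeM_homLift hDo hDc hq p)

theorem log_gaugeM_homLift_triangle (hDo : IsOpen D) (hDc : Convex ℝ D)
    {p q r : EuclideanSpace ℝ (Fin n)} (hq : q ∈ D) (hr : r ∈ D) :
    Real.log (gaugeM (coneOver D) (homLift p) (homLift r)) ≤
      Real.log (gaugeM (coneOver D) (homLift p) (homLift q)) +
        Real.log (gaugeM (coneOver D) (homLift q) (homLift r)) := by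
  have h1 := one_le_gaugeM_homLift hDo hDc hq p
  have h2 := one_le_gaugeM_homLift hDo hDc hr q
  have h3 := one_le_gaugeM_homLift hDo hDc hr p
  rw [← Real.log_mul (by linarith) (by linarith)]
  exact Real.log_le_log (by linarith) (gaugeM_triangle (K := homCone hDc) (isOpen_coneOver hDo)
    (homLift_mem_coneOver hq) (homLift_mem_coneOver hr) _)

theorem hilbertDist_triangle (hDo : IsOpen D) (hDc : Convex ℝ D) (hDb : Bornology.IsBounded D)
    {p q r : EuclideanSpace ℝ (Fin n)} (hp : p ∈ D) (hq : q ∈ D) (hr : r ∈ D) :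
    hilbertDist D p r ≤ hilbertDist D p q + hilbertDist D q r := by
  rw [hilbertDist_eq hDo hDc hDb hp hr, hilbertDist_eq hDo hDc hDb hp hq,
    hilbertDist_eq hDo hDc hDb hq hr]
  linarith [log_gaugeM_homLift_triangle hDo hDc (p := p) hq hr,
    log_gaugeM_homLift_triangle hDo hDc (p := r) hq hp]

theorem hilbertDist_comm (hDo : IsOpen D) (hDc : Convex ℝ D) (hDb : Bornology.IsBounded D)
    {p q : EuclideanSpace ℝ (Fin n)} (hp : p ∈ D) (hq : q ∈ D) :
    hilbertDist D p q = hilbertDist D q p := by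
  rw [hilbertDist_eq hDo hDc hDb hp hq, hilbertDist_eq hDo hDc hDb hq hp, add_comm]

theorem hilbertDist_nonneg (hDo : IsOpen D) (hDc : Convex ℝ D) (hDb : Bornology.IsBounded D)
    {p q : EuclideanSpace ℝ (Fin n)} (hp : p ∈ D) (hq : q ∈ D) : 0 ≤ hilbertDist D p q := by
  rw [hilbertDist_eq hDo hDc hDb hp hq]
  exact add_nonneg (log_gaugeM_homLift_nonneg hDo hDc hq p) (log_gaugeM_homLift_nonneg hDo hDc hp q)

theorem eventually_gaugeM_homLift_le (hDo : IsOpen D) (hDc : Convex ℝ D)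
    {q : EuclideanSpace ℝ (Fin n)} (hq : q ∈ D) {c : ℝ} (hc : 1 < c) :
    ∀ᶠ p in 𝓝 q, gaugeM (coneOver D) (homLift p) (homLift q) ≤ c ∧
      gaugeM (coneOver D) (homLift q) (homLift p) ≤ c := by
  have hC := isOpen_coneOver hDo
  have hmem : c • homLift q - homLift q ∈ coneOver D := by
    have := (homCone hDc).smul_mem (sub_pos.2 hc) (homLift_mem_coneOver hq)
    rwa [sub_smul, one_smul] at this
  have c1 : ContinuousAt (fun p => c • homLift q - homLift p) q :=
    (continuous_const.sub continuous_homLift).continuousAt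
  have c2 : ContinuousAt (fun p => c • homLift p - homLift q) q :=
    ((continuous_homLift.const_smul c).sub continuous_const).continuousAt
  filter_upwards [c1.eventually_mem (hC.mem_nhds hmem), c2.eventually_mem (hC.mem_nhds hmem),
    hDo.mem_nhds hq] with p h1 h2 hp
  exact ⟨(gaugeM_le_iff (K := homCone hDc) hC (homLift_mem_coneOver hq) (by linarith)).2
      (subset_closure h1),
    (gaugeM_le_iff (K := homCone hDc) hC (homLift_mem_coneOver hp) (by linarith)).2
      (subset_closure h2)⟩

theorem isCompact_gaugeM_le (hDo : IsOpen D) (hDc : Convex ℝ D) (hDb : Bornology.IsBounded D)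
    {b : EuclideanSpace ℝ (Fin n)} (hb : b ∈ D) (R : ℝ) :
    IsCompact {p ∈ D | gaugeM (coneOver D) (homLift b) (homLift p) ≤ R} := by
  have hC := isOpen_coneOver hDo
  have heq : {p ∈ D | gaugeM (coneOver D) (homLift b) (homLift p) ≤ R} =
      closure D ∩ {p | R • homLift p - homLift b ∈ closure (coneOver D)} := by
    ext p
    constructor
    · rintro ⟨hp, hR⟩
      exact ⟨subset_closure hp, (gaugeM_le_iff (K := homCone hDc) hC (homLift_mem_coneOver hp)
        ((gaugeM_nonneg _ _ _).trans hR)).1 hR⟩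
    · rintro ⟨-, hR⟩
      have h1 := add_mem_of_mem_closure (K := homCone hDc) hC hR (homLift_mem_coneOver hb)
      rw [sub_add_cancel] at h1
      obtain ⟨h2, h3⟩ := mem_coneOver_iff.1 h1
      simp only [WithLp.smul_snd, WithLp.smul_fst, homLift_fst, homLift_snd, smul_eq_mul,
        mul_one] at h2 h3
      rw [smul_smul, inv_mul_cancel₀ h2.ne', one_smul] at h3
      exact ⟨h3, (gaugeM_le_iff (K := homCone hDc) hC (homLift_mem_coneOver h3) h2.le).2 hR⟩
  rw [heq]
  refine Metric.isCompact_of_isClosed_isBounded (isClosed_closure.inter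
    (isClosed_closure.preimage ((continuous_homLift.const_smul R).sub continuous_const)))
    (hDb.closure.subset inter_subset_left)

theorem exists_finset_gaugeM_le (hDo : IsOpen D) (hDc : Convex ℝ D)
    {A : Set (EuclideanSpace ℝ (Fin n))} (hA : IsCompact A) (hAD : A ⊆ D) {c : ℝ} (hc : 1 < c) :
    ∃ s : Finset (EuclideanSpace ℝ (Fin n)), (∀ q ∈ s, q ∈ D) ∧ ∀ p ∈ A, ∃ q ∈ s,
      gaugeM (coneOver D) (homLift p) (homLift q) ≤ c ∧
        gaugeM (coneOver D) (homLift q) (homLift p) ≤ c := by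
  obtain ⟨s, hs, hcov⟩ := hA.elim_nhds_subcover
    (fun q => {p | gaugeM (coneOver D) (homLift p) (homLift q) ≤ c ∧
      gaugeM (coneOver D) (homLift q) (homLift p) ≤ c})
    (fun q hq => eventually_gaugeM_homLift_le hDo hDc (hAD hq) hc)
  refine ⟨s, fun q hq => hAD (hs q hq), fun p hp => ?_⟩
  obtain ⟨q, hq, hpq⟩ := mem_iUnion₂.1 (hcov hp)
  exact ⟨q, hq, hpq⟩

/-- A set that is bounded for the Hilbert metric lies in a sublevel set of the gauge. -/
theorem exists_gaugeM_le_of_mem_symBoundedSets (hDo : IsOpen D) (hDc : Convex ℝ D)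
    (hDb : Bornology.IsBounded D) (b : EuclideanSpace ℝ (Fin n)) {B : Set D}
    (hB : B ∈ symBoundedSets fun p q : D => hilbertDist D (p : EuclideanSpace ℝ (Fin n)) q) :
    ∃ R : ℝ, ∀ p ∈ B, gaugeM (coneOver D) (homLift b)
      (homLift (p : EuclideanSpace ℝ (Fin n))) ≤ R := by
  obtain ⟨R, hR⟩ := hB
  rcases B.eq_empty_or_nonempty with rfl | ⟨p₀, hp₀⟩
  · exact ⟨0, by simp⟩
  refine ⟨gaugeM (coneOver D) (homLift b) (homLift (p₀ : EuclideanSpace ℝ (Fin n))) * Real.exp R,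
    fun p hp => ?_⟩
  refine (gaugeM_triangle (K := homCone hDc) (isOpen_coneOver hDo) (homLift_mem_coneOver p₀.2)
    (homLift_mem_coneOver p.2) _).trans (mul_le_mul_of_nonneg_left ?_ (gaugeM_nonneg _ _ _))
  have h1 := hR p hp p₀ hp₀
  have h2 := hilbertDist_nonneg hDo hDc hDb p.2 p₀.2
  simp only [hilbertDist_eq hDo hDc hDb p₀.2 p.2] at h1
  have h3 := log_gaugeM_homLift_nonneg hDo hDc p₀.2 (p : EuclideanSpace ℝ (Fin n))
  have h4 := one_le_gaugeM_homLift hDo hDc p.2 (p₀ : EuclideanSpace ℝ (Fin n))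
  rw [coe_homCone]
  exact (Real.log_le_iff_le_exp (by linarith)).1 (by linarith)

theorem abs_distFn_sub_distFn_le (hDo : IsOpen D) (hDc : Convex ℝ D)
    (hDb : Bornology.IsBounded D) (b p y q : D) :
    |distFn (fun p q : D => hilbertDist D (p : EuclideanSpace ℝ (Fin n)) q) b q p -
      distFn (fun p q : D => hilbertDist D (p : EuclideanSpace ℝ (Fin n)) q) b y p| ≤
      2 * hilbertDist D (y : EuclideanSpace ℝ (Fin n)) q := by
  have t1 := hilbertDist_triangle hDo hDc hDb p.2 y.2 q.2
  have t2 := hilbertDist_triangle hDo hDc hDb p.2 q.2 y.2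
  have t3 := hilbertDist_triangle hDo hDc hDb b.2 y.2 q.2
  have t4 := hilbertDist_triangle hDo hDc hDb b.2 q.2 y.2
  rw [hilbertDist_comm hDo hDc hDb q.2 y.2] at t2 t4
  simp only [distFn]
  rw [abs_le]
  constructor <;> linarith

/-- An almost-geodesic that converges to a horofunction leaves every bounded set: otherwise it has
an accumulation point `y` in `D`, and its limit is `ψ_y`. -/
theorem frequently_le_hilbertDist (hDo : IsOpen D) (hDc : Convex ℝ D)
    (hDb : Bornology.IsBounded D) {b : D} {h : D → ℝ} {ι : Type*} {l : Filter ι} [l.NeBot]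
    {γ : ι → D}
    (hlim : ∀ p, Tendsto (fun t => distFn
      (fun p q : D => hilbertDist D (p : EuclideanSpace ℝ (Fin n)) q) b (γ t) p) l (𝓝 (h p)))
    (hh : h ∉ range (distFn (fun p q : D => hilbertDist D (p : EuclideanSpace ℝ (Fin n)) q) b))
    (A : ℝ) : ∃ᶠ t in l, A ≤ hilbertDist D (b : EuclideanSpace ℝ (Fin n)) (γ t) := by
  by_contra hcon
  rw [not_frequently] at hcon
  have hK := isCompact_gaugeM_le hDo hDc hDb b.2 (Real.exp A)
  have hev : ∀ᶠ t in l, (γ t : EuclideanSpace ℝ (Fin n)) ∈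
      {p ∈ D | gaugeM (coneOver D) (homLift (b : EuclideanSpace ℝ (Fin n))) (homLift p) ≤
        Real.exp A} := by
    filter_upwards [hcon] with t ht
    refine ⟨(γ t).2, ?_⟩
    rw [hilbertDist_eq hDo hDc hDb b.2 (γ t).2] at ht
    have h1 := log_gaugeM_homLift_nonneg hDo hDc b.2 (γ t : EuclideanSpace ℝ (Fin n))
    have h2 := one_le_gaugeM_homLift hDo hDc (γ t).2 (b : EuclideanSpace ℝ (Fin n))
    exact (Real.log_le_iff_le_exp (by linarith)).1 (by linarith)
  obtain ⟨y, hy, hcl⟩ := hK (f := map (fun t => (γ t : EuclideanSpace ℝ (Fin n))) l)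
    (le_principal_iff.2 hev)
  refine hh ⟨⟨y, hy.1⟩, funext fun p => ?_⟩
  refine eq_of_abs_sub_le_all fun ε hε => ?_
  have hnear : ∃ᶠ t in l, hilbertDist D y (γ t) ≤ ε / 4 := by
    have := (mapClusterPt_iff_frequently.1 hcl) _ (eventually_gaugeM_homLift_le hDo hDc hy.1
      (Real.one_lt_exp_iff.2 (show (0 : ℝ) < ε / 8 by linarith)))
    refine this.mono fun t ht => ?_
    have h1 := one_le_gaugeM_homLift hDo hDc hy.1 (γ t : EuclideanSpace ℝ (Fin n))
    have h2 := one_le_gaugeM_homLift hDo hDc (γ t).2 y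
    rw [hilbertDist_eq hDo hDc hDb hy.1 (γ t).2]
    have e1 := (Real.log_le_iff_le_exp (by linarith)).2 ht.1
    have e2 := (Real.log_le_iff_le_exp (by linarith)).2 ht.2
    linarith
  obtain ⟨t, ht1, ht2⟩ := (hnear.and_eventually
    ((Metric.tendsto_nhds.1 (hlim p)) (ε / 2) (half_pos hε))).exists
  have h3 := abs_distFn_sub_distFn_le hDo hDc hDb b p ⟨y, hy.1⟩ (γ t)
  rw [Real.dist_eq] at ht2
  rw [abs_sub_comm] at h3
  have h4 := abs_sub_le (distFn (fun p q : D => hilbertDist D (p : EuclideanSpace ℝ (Fin n)) q) b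
    ⟨y, hy.1⟩ p) (distFn (fun p q : D => hilbertDist D (p : EuclideanSpace ℝ (Fin n)) q) b
    (γ t) p) (h p)
  linarith

end HilbertMetric

/-! ### Points that realise a Funk Busemann point together with a reverse-Funk horofunction -/

section Realisation

variable {n : ℕ} {D : Set (EuclideanSpace ℝ (Fin n))} {E : ConvexCone ℝ (HomSpace n)}
  {z : HomSpace n}

theorem closure_subset_closure_of_dualCone_subset {C : ConvexCone ℝ (HomSpace n)}
    (hsub : dualCone (E : Set (HomSpace n)) ⊆ dualCone (C : Set (HomSpace n))) (hz : z ∈ E) :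
    closure (C : Set (HomSpace n)) ⊆ closure (E : Set (HomSpace n)) :=
  fun _ hv => mem_closure_cone_of_forall_dual hz fun _ hu =>
    inner_nonneg_of_mem_closure (hsub hu) hv

theorem gaugeM_pos_of_dualCone_subset (hDo : IsOpen D) (hE : IsOpen (E : Set (HomSpace n)))
    (hsub : dualCone (E : Set (HomSpace n)) ⊆ dualCone (coneOver D))
    (hE0 : dualCone (E : Set (HomSpace n)) ≠ {0}) (hz : z ∈ E) {w : HomSpace n}
    (hw : w ∈ coneOver D) : 0 < gaugeM (E : Set (HomSpace n)) w z := by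
  have h0 : (0 : HomSpace n) ∈ dualCone (E : Set (HomSpace n)) :=
    mem_dualCone.2 fun v _ => by simp
  obtain ⟨u, hu, hu0⟩ : ∃ u ∈ dualCone (E : Set (HomSpace n)), u ≠ 0 := by
    by_contra hcon
    push Not at hcon
    exact hE0 (Subset.antisymm hcon (singleton_subset_iff.2 h0))
  exact gaugeM_pos_of_inner_pos hE hz hu (inner_pos_of_mem (isOpen_coneOver hDo) (hsub hu) hu0 hw)

/-- For `e ∈ E`, the point `z - e` is below `z` for the order of `E`, whence
`M(p/(z - e); C) ≥ M(p/z; E)` as soon as `z - e ∈ C`. Since `E` is downward directed for the order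
of `C`, there are such `e` for which this is almost an equality, uniformly on a compact set. -/
theorem exists_gaugeM_le_mul_gaugeM (hDo : IsOpen D) (hDc : Convex ℝ D)
    (hE : IsOpen (E : Set (HomSpace n)))
    (hext : IsExtreme ℝ (dualCone (coneOver D)) (dualCone (E : Set (HomSpace n))))
    (hE0 : dualCone (E : Set (HomSpace n)) ≠ {0}) (hz : z ∈ E)
    {b : EuclideanSpace ℝ (Fin n)} (hb : b ∈ D)
    {A : Set (EuclideanSpace ℝ (Fin n))} (hA : IsCompact A) (hAD : A ⊆ D) {c : ℝ} (hc : 1 < c) :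
    ∃ e ∈ E, z - e ∈ coneOver D ∧ ∀ p ∈ A, gaugeM (coneOver D) (homLift p) (z - e) ≤
      c ^ 3 * gaugeM (E : Set (HomSpace n)) (homLift p) z := by
  classical
  have hC := isOpen_coneOver hDo
  have hc0 : 0 < c := by linarith
  obtain ⟨s, hsD, hs⟩ := exists_finset_gaugeM_le hDo hDc hA hAD hc
  have hsD' : ∀ q ∈ insert b s, q ∈ D := by
    intro q hq
    rcases Finset.mem_insert.1 hq with rfl | hq
    exacts [hb, hsD q hq]
  set g : EuclideanSpace ℝ (Fin n) → ℝ := fun q => gaugeM (E : Set (HomSpace n)) (homLift q) z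
    with hg
  have hgpos : ∀ q ∈ D, 0 < g q := fun q hq =>
    gaugeM_pos_of_dualCone_subset hDo hE hext.subset hE0 hz (homLift_mem_coneOver hq)
  have ha : ∀ q ∈ insert b s, z - (c * g q)⁻¹ • homLift q ∈ E := by
    intro q hq
    have hq0 := hgpos q (hsD' q hq)
    have hcg : 0 < c * g q := mul_pos hc0 hq0
    have h1 := add_mem_of_mem_closure hE (gaugeM_smul_sub_mem hE hz (homLift q))
      (E.smul_mem (mul_pos (sub_pos.2 hc) hq0) hz)
    have h2 := E.smul_mem (inv_pos.2 hcg) h1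
    convert h2 using 1
    change _ = (c * g q)⁻¹ • (g q • z - homLift q + ((c - 1) * g q) • z)
    have : g q • z - homLift q + ((c - 1) * g q) • z = (c * g q) • z - homLift q := by module
    rw [this, smul_sub, smul_smul, inv_mul_cancel₀ hcg.ne', one_smul]
  obtain ⟨e, he, hes⟩ := exists_common_lower_bound_finset (C := homCone hDc) hC
    ⟨_, homLift_mem_coneOver hb⟩ hE hext hz (insert b s) _ ha
  have hze : ∀ q ∈ insert b s, z - e - (c * g q)⁻¹ • homLift q ∈ homCone hDc := by
    intro q hq
    have := hes q hq
    rwa [sub_right_comm] at this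
  have hmem : z - e ∈ homCone hDc := by
    have hb' := Finset.mem_insert_self b s
    have h1 := (homCone hDc).add_mem (hze b hb') ((homCone hDc).smul_mem
      (inv_pos.2 (mul_pos hc0 (hgpos b hb))) (homLift_mem_coneOver hb))
    rwa [sub_add_cancel] at h1
  refine ⟨e, he, hmem, fun p hp => ?_⟩
  obtain ⟨q, hq, hpq, hqp⟩ := hs p hp
  have hq' : q ∈ insert b s := Finset.mem_insert_of_mem hq
  have hcg : 0 < c * g q := mul_pos hc0 (hgpos q (hsD q hq))
  have h1 : gaugeM (coneOver D) (homLift q) (z - e) ≤ c * g q := by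
    refine (gaugeM_le_iff (K := homCone hDc) hC hmem hcg.le).2 ?_
    have := (homCone hDc).smul_mem hcg (hze q hq')
    rw [smul_sub, smul_smul, mul_inv_cancel₀ hcg.ne', one_smul] at this
    exact subset_closure this
  have h2 : g q ≤ c * g p := by
    have h3 := (gaugeM_le_iff (K := homCone hDc) hC (homLift_mem_coneOver (hAD hp)) hc0.le).1 hqp
    have h4 := gaugeM_mono hE hz
      (closure_subset_closure_of_dualCone_subset (C := homCone hDc) hext.subset hz h3)
    rwa [gaugeM_smul_left hE hz _ hc0] at h4
  calc gaugeM (coneOver D) (homLift p) (z - e)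
      ≤ gaugeM (coneOver D) (homLift p) (homLift q) * gaugeM (coneOver D) (homLift q) (z - e) :=
        gaugeM_triangle (K := homCone hDc) hC (homLift_mem_coneOver (hsD q hq)) hmem _
    _ ≤ c * (c * (c * g p)) :=
        mul_le_mul hpq (h1.trans (mul_le_mul_of_nonneg_left h2 hc0.le)) (gaugeM_nonneg _ _ _) hc0.le
    _ = _ := by simp only [hg]; ring

/-- Adding a large multiple of `x` to the point of the previous lemma makes it converge to `x`
projectively. If `E*` lies in the exposed face of `x`, this does not affect its position with
respect to `z` in the order of `E`. -/
theorem exists_realising_point (hDo : IsOpen D) (hDc : Convex ℝ D) (hDb : Bornology.IsBounded D)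
    (hE : IsOpen (E : Set (HomSpace n)))
    (hext : IsExtreme ℝ (dualCone (coneOver D)) (dualCone (E : Set (HomSpace n))))
    (hE0 : dualCone (E : Set (HomSpace n)) ≠ {0}) (hz : z ∈ E)
    {b x : EuclideanSpace ℝ (Fin n)} (hb : b ∈ D) (hx : x ∈ closure D)
    (hface : dualCone (E : Set (HomSpace n)) ⊆ exposedFaceAt (coneOver D) (homLift x))
    (R A : ℝ) {c : ℝ} (hc : 1 < c) :
    ∃ y ∈ coneOver D, ∃ μ : ℝ, 0 < μ ∧ A ≤ μ ∧
      gaugeM (E : Set (HomSpace n)) y z ≤ 1 ∧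
      gaugeM (coneOver D) (homLift x) y ≤ μ⁻¹ ∧
      (∀ p ∈ D, gaugeM (E : Set (HomSpace n)) (homLift p) z ≤ gaugeM (coneOver D) (homLift p) y) ∧
      (∀ p ∈ D, μ * gaugeM (coneOver D) (homLift x) (homLift p) ≤
        gaugeM (coneOver D) y (homLift p)) ∧
      ∀ p ∈ D, gaugeM (coneOver D) (homLift b) (homLift p) ≤ R →
        gaugeM (coneOver D) (homLift p) y ≤
          c ^ 3 * gaugeM (E : Set (HomSpace n)) (homLift p) z ∧
        gaugeM (coneOver D) y (homLift p) ≤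
          c * (μ * gaugeM (coneOver D) (homLift x) (homLift p)) := by
  have hC := isOpen_coneOver hDo
  obtain ⟨e, he, hy₀, hle⟩ := exists_gaugeM_le_mul_gaugeM hDo hDc hE hext hE0 hz hb
    (isCompact_gaugeM_le hDo hDc hDb hb R) (fun _ hp => hp.1) hc
  set y₀ := z - e with hy₀_def
  set G := gaugeM (coneOver D) y₀ (homLift b) with hG
  set μ : ℝ := max (max A 1) (G * R / (c - 1)) with hμ
  have hμ0 : 0 < μ := lt_of_lt_of_le one_pos ((le_max_right A 1).trans (le_max_left _ _))
  have hxcl : μ • homLift x ∈ closure (coneOver D) :=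
    smul_mem_closure_cone (homCone hDc) hμ0 (homLift_mem_closure_coneOver hx)
  have hy : μ • homLift x + y₀ ∈ coneOver D :=
    add_mem_of_mem_closure (K := homCone hDc) hC hxcl hy₀
  have hyu : ∀ u ∈ dualCone (E : Set (HomSpace n)), ⟪μ • homLift x + y₀, u⟫ ≤ ⟪z, u⟫ := by
    intro u hu
    have h1 := (hface hu).2
    rw [real_inner_comm] at h1
    have h2 := mem_dualCone.1 hu e he
    rw [inner_add_left, real_inner_smul_left, h1, mul_zero, zero_add, hy₀_def, inner_sub_left]
    linarith
  have hmono : ∀ p : EuclideanSpace ℝ (Fin n),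
      gaugeM (coneOver D) (homLift p) (μ • homLift x + y₀) ≤
        gaugeM (coneOver D) (homLift p) y₀ := by
    intro p
    have h1 : gaugeM (coneOver D) y₀ (μ • homLift x + y₀) ≤ 1 := by
      refine (gaugeM_le_iff (K := homCone hDc) hC hy zero_le_one).2 ?_
      rw [one_smul, add_sub_cancel_right]
      exact hxcl
    calc _ ≤ _ := gaugeM_triangle (K := homCone hDc) hC hy₀ hy _
      _ ≤ _ := mul_le_of_le_one_right (gaugeM_nonneg _ _ _) h1
  refine ⟨μ • homLift x + y₀, hy, μ, hμ0, (le_max_left A 1).trans (le_max_left _ _),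
    ?_, ?_, fun p hp => ?_, fun p hp => ?_, fun p hp hpR => ⟨?_, ?_⟩⟩
  · refine (gaugeM_le_iff_dual hE hz zero_le_one).2 fun u hu => ?_
    rw [one_mul]
    exact hyu u hu
  · refine (gaugeM_le_iff (K := homCone hDc) hC hy (inv_pos.2 hμ0).le).2 ?_
    rw [smul_add, smul_smul, inv_mul_cancel₀ hμ0.ne', one_smul, add_sub_cancel_left]
    exact subset_closure ((homCone hDc).smul_mem (inv_pos.2 hμ0) hy₀)
  · refine (gaugeM_le_iff_dual hE hz (gaugeM_nonneg _ _ _)).2 fun u hu => ?_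
    exact (inner_le_gaugeM_mul (K := homCone hDc) hC hy _ (hext.subset hu)).trans
      (mul_le_mul_of_nonneg_left (hyu u hu) (gaugeM_nonneg _ _ _))
  · have h1 := gaugeM_mono (K := homCone hDc) hC (homLift_mem_coneOver hp)
      (v := μ • homLift x) (w := μ • homLift x + y₀)
      (by rw [add_sub_cancel_left]; exact subset_closure hy₀)
    rwa [gaugeM_smul_left (K := homCone hDc) hC (homLift_mem_coneOver hp) _ hμ0] at h1
  · exact (hmono p).trans (hle p ⟨hp, hpR⟩)
  · have h1 := gaugeM_add_le (K := homCone hDc) hC (homLift_mem_coneOver hp) (μ • homLift x) y₀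
    rw [gaugeM_smul_left (K := homCone hDc) hC (homLift_mem_coneOver hp) _ hμ0, coe_homCone] at h1
    have h2 : gaugeM (coneOver D) y₀ (homLift p) ≤ G * R :=
      (gaugeM_triangle (K := homCone hDc) hC (homLift_mem_coneOver hb)
        (homLift_mem_coneOver hp) y₀).trans (mul_le_mul_of_nonneg_left hpR (gaugeM_nonneg _ _ _))
    have h3 : G * R ≤ μ * (c - 1) :=
      (div_le_iff₀ (sub_pos.2 hc)).1 (le_max_right (max A 1) (G * R / (c - 1)))
    have h4 : μ * (c - 1) ≤ μ * (c - 1) * gaugeM (coneOver D) (homLift x) (homLift p) :=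
      le_mul_of_one_le_right (mul_nonneg hμ0.le (by linarith)) (one_le_gaugeM_homLift hDo hDc hp x)
    linarith

/-- The points of the previous lemma, projected to `D` and expressed in the Hilbert metric. -/
theorem exists_hilbert_realising_point (hDo : IsOpen D) (hDc : Convex ℝ D)
    (hDb : Bornology.IsBounded D) (hE : IsOpen (E : Set (HomSpace n)))
    (hext : IsExtreme ℝ (dualCone (coneOver D)) (dualCone (E : Set (HomSpace n))))
    (hE0 : dualCone (E : Set (HomSpace n)) ≠ {0}) (hz : z ∈ E)
    (b : D) {x : EuclideanSpace ℝ (Fin n)} (hx : x ∈ closure D)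
    (hface : dualCone (E : Set (HomSpace n)) ⊆ exposedFaceAt (coneOver D) (homLift x))
    (R A : ℝ) {ε : ℝ} (hε : 0 < ε) :
    ∃ q : D, (∀ p : D, gaugeM (coneOver D) (homLift (b : EuclideanSpace ℝ (Fin n)))
        (homLift (p : EuclideanSpace ℝ (Fin n))) ≤ R →
        |distFn (fun p q : D => hilbertDist D (p : EuclideanSpace ℝ (Fin n)) q) b q p -
          (revHoro D (b : EuclideanSpace ℝ (Fin n)) x p +
            funkBusemann D (b : EuclideanSpace ℝ (Fin n)) (E : Set (HomSpace n)) z p)| ≤ ε) ∧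
      A ≤ hilbertDist D (b : EuclideanSpace ℝ (Fin n)) q ∧
      hilbertDist D (b : EuclideanSpace ℝ (Fin n)) q +
        (revHoro D (b : EuclideanSpace ℝ (Fin n)) x q +
          funkBusemann D (b : EuclideanSpace ℝ (Fin n)) (E : Set (HomSpace n)) z q) ≤ ε := by
  have hC := isOpen_coneOver hDo
  set g : EuclideanSpace ℝ (Fin n) → ℝ := fun q => gaugeM (E : Set (HomSpace n)) (homLift q) z
    with hg
  set m : EuclideanSpace ℝ (Fin n) → EuclideanSpace ℝ (Fin n) → ℝ := fun p q =>
    gaugeM (coneOver D) (homLift p) (homLift q) with hm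
  have hgpos : ∀ q ∈ D, 0 < g q := fun q hq =>
    gaugeM_pos_of_dualCone_subset hDo hE hext.subset hE0 hz (homLift_mem_coneOver hq)
  have hmpos : ∀ p, ∀ q ∈ D, 0 < m p q := fun p q hq =>
    one_pos.trans_le (one_le_gaugeM_homLift hDo hDc hq p)
  obtain ⟨y, hy, μ, hμ0, hμA, hyz, hxy, hlow1, hlow2, hup⟩ :=
    exists_realising_point hDo hDc hDb hE hext hE0 hz b.2 hx hface (max R 1)
      (Real.exp (A - Real.log (g b))) (Real.one_lt_exp_iff.2 (show (0 : ℝ) < ε / 4 by linarith))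
  obtain ⟨q, hq, t, ht, rfl⟩ := hy
  have hqC : homLift q ∈ homCone hDc := homLift_mem_coneOver hq
  have hdiv : ∀ p, gaugeM (coneOver D) (homLift p) (t • homLift q) = m p q / t := fun p =>
    gaugeM_smul_right (K := homCone hDc) hC hqC _ ht
  have hmul : ∀ p ∈ D, gaugeM (coneOver D) (t • homLift q) (homLift p) = t * m q p := fun p hp =>
    gaugeM_smul_left (K := homCone hDc) hC (homLift_mem_coneOver hp) _ ht
  rw [gaugeM_smul_left hE hz _ ht] at hyz
  rw [hdiv] at hxy
  -- The projection to `D` changes neither the Hilbert distance nor the horofunctions: the factors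
  -- `t` and `1 / t` cancel.
  have hd : ∀ p (hp : p ∈ D), hilbertDist D p q = Real.log (m p q / t) + Real.log (t * m q p) := by
    intro p hp
    rw [hilbertDist_eq hDo hDc hDb hp hq, Real.log_div (hmpos p q hq).ne' ht.ne',
      Real.log_mul ht.ne' (hmpos q p hp).ne']
    simp only [hm]
    ring
  have hlo : ∀ p ∈ D, Real.log (g p) + (Real.log μ + Real.log (m x p)) ≤ hilbertDist D p q := by
    intro p hp
    rw [hd p hp, ← Real.log_mul hμ0.ne' (hmpos x p hp).ne']
    have h1 := hlow1 p hp
    have h2 := hlow2 p hp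
    rw [hdiv] at h1
    rw [hmul p hp] at h2
    exact add_le_add (Real.log_le_log (hgpos p hp) h1)
      (Real.log_le_log (mul_pos hμ0 (hmpos x p hp)) h2)
  have hhi : ∀ p ∈ D, m b p ≤ max R 1 →
      hilbertDist D p q ≤ Real.log (g p) + (Real.log μ + Real.log (m x p)) + ε := by
    intro p hp hpR
    obtain ⟨h1, h2⟩ := hup p hp hpR
    rw [hdiv] at h1
    rw [hmul p hp] at h2
    have e1 := Real.log_le_log (div_pos (hmpos p q hq) ht) h1
    have e2 := Real.log_le_log (mul_pos ht (hmpos q p hp)) h2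
    rw [Real.log_mul (by positivity) (hgpos p hp).ne', Real.log_pow, Real.log_exp] at e1
    rw [Real.log_mul (Real.exp_pos _).ne' (mul_pos hμ0 (hmpos x p hp)).ne', Real.log_exp,
      Real.log_mul hμ0.ne' (hmpos x p hp).ne'] at e2
    rw [hd p hp]
    push_cast at e1
    linarith
  have hh : ∀ p : D, revHoro D (b : EuclideanSpace ℝ (Fin n)) x p +
      funkBusemann D (b : EuclideanSpace ℝ (Fin n)) (E : Set (HomSpace n)) z p =
      Real.log (m x p) - Real.log (m x b) + (Real.log (g p) - Real.log (g b)) := by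
    intro p
    rw [revHoro, revFunkDist_eq hDo hDc hDb p.2, revFunkDist_eq hDo hDc hDb b.2,
      funkBusemann_eq hE hz (hgpos b b.2), Real.log_div (hgpos p p.2).ne' (hgpos b b.2).ne']
  have hbb : m b b ≤ max R 1 := (gaugeM_homLift_self hDo hDc b.2).le.trans (le_max_right _ _)
  have hblo := hlo b b.2
  have hbhi := hhi b b.2 hbb
  refine ⟨⟨q, hq⟩, fun p hp => ?_, ?_, ?_⟩
  · have h1 := hlo p p.2
    have h2 := hhi p p.2 (hp.trans (le_max_left _ _))
    rw [hh, abs_le]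
    simp only [distFn]
    constructor <;> linarith
  · have h1 := (Real.le_log_iff_exp_le hμ0).2 hμA
    have h2 := log_gaugeM_homLift_nonneg hDo hDc b.2 x
    change A ≤ hilbertDist D b q
    have h3 : 0 ≤ Real.log (m x b) := h2
    linarith
  · rw [hh]
    change hilbertDist D b q + (Real.log (m x q) - Real.log (m x b) +
      (Real.log (g q) - Real.log (g b))) ≤ ε
    have h1 := Real.log_le_log (div_pos (hmpos x q hq) ht) hxy
    rw [Real.log_div (hmpos x q hq).ne' ht.ne', Real.log_inv] at h1
    have h2 := Real.log_nonpos (mul_pos ht (hgpos q hq)).le hyz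
    rw [Real.log_mul ht.ne' (hgpos q hq).ne'] at h2
    linarith

end Realisation

/-! ### Busemann points of the form `r_x + f` -/

theorem mainTheorem3 (n : ℕ) (D : Set (EuclideanSpace ℝ (Fin n)))
    (hDopen : IsOpen D) (hDconv : Convex ℝ D) (hDbdd : Bornology.IsBounded D) (b : D)
    (x : EuclideanSpace ℝ (Fin n)) (hx : x ∈ closure D \ D)
    (E : ConvexCone ℝ (HomSpace n)) (hEopen : IsOpen (E : Set (HomSpace n)))
    (hEext : IsExtremeSet (dualCone (coneOver D)) (dualCone (E : Set (HomSpace n))))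
    (hEproper : dualCone (E : Set (HomSpace n)) ≠ dualCone (coneOver D))
    (hEzero : dualCone (E : Set (HomSpace n)) ≠ {0})
    (z : HomSpace n) (hz : z ∈ E) :
    IsBusemannPoint (fun p q : D => hilbertDist D (p : EuclideanSpace ℝ (Fin n)) q) b
        (fun p : D => revHoro D (b : EuclideanSpace ℝ (Fin n)) x p
          + funkBusemann D (b : EuclideanSpace ℝ (Fin n)) (E : Set (HomSpace n)) z p) ↔
      dualCone (E : Set (HomSpace n)) ⊆ exposedFaceAt (coneOver D) (homLift x) := by
  have hext := hEext.2
  have hsub := hext.subset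
  constructor
  · -- A Busemann point `h` is unbounded below, and `⟪x, u⟫ ≤ M(x/q; C) M(q/z; E) ⟪z, u⟫` for
    -- `u ∈ E*`, where the product of the gauges is a constant multiple of `exp (h q)`.
    rintro ⟨⟨-, hrange⟩, T, γ, hγ, hlim⟩ u hu
    refine ⟨hsub hu, ?_⟩
    have hlow := inner_nonneg_of_mem_closure (hsub hu) (homLift_mem_closure_coneOver hx.1)
    rw [real_inner_comm]
    refine le_antisymm ?_ hlow
    have : Nonempty T := ⟨⟨0, hγ.2.1⟩⟩
    have hev := hγ.eventually_le (fun p : D => hilbertDist_self (p : EuclideanSpace ℝ (Fin n))) hlim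
    have hfr := frequently_le_hilbertDist hDopen hDconv hDbdd
      (tendsto_apply_of_tendsto_toUnif hlim) hrange
    have hgpos : ∀ q ∈ D, 0 < gaugeM (E : Set (HomSpace n)) (homLift q) z := fun q hq =>
      gaugeM_pos_of_dualCone_subset hDopen hEopen hsub hEzero hz (homLift_mem_coneOver hq)
    have hmpos : ∀ q ∈ D, 0 < gaugeM (coneOver D) (homLift x) (homLift q) := fun q hq =>
      one_pos.trans_le (one_le_gaugeM_homLift hDopen hDconv hq x)
    have hzu := mem_dualCone.1 hu z hz
    set κ := gaugeM (coneOver D) (homLift x) (homLift (b : EuclideanSpace ℝ (Fin n))) *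
      gaugeM (E : Set (HomSpace n)) (homLift (b : EuclideanSpace ℝ (Fin n))) z with hκ
    have hκ0 : 0 < κ := mul_pos (hmpos b b.2) (hgpos b b.2)
    have hbound : ∀ A : ℝ, ⟪homLift x, u⟫ ≤ Real.exp (1 - A) * κ * ⟪z, u⟫ := by
      intro A
      obtain ⟨t, htA, ht1⟩ := ((hfr A).and_eventually hev).exists
      set q : D := γ t with hq
      have e1 := inner_le_gaugeM_mul (K := homCone hDconv) (isOpen_coneOver hDopen)
        (homLift_mem_coneOver q.2) (homLift x) (hsub hu)
      have e2 := inner_le_gaugeM_mul hEopen hz (homLift (q : EuclideanSpace ℝ (Fin n))) hu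
      have e3 : gaugeM (coneOver D) (homLift x) (homLift (q : EuclideanSpace ℝ (Fin n))) *
          gaugeM (E : Set (HomSpace n)) (homLift (q : EuclideanSpace ℝ (Fin n))) z ≤
          Real.exp (1 - A) * κ := by
        rw [← Real.log_le_log_iff (mul_pos (hmpos q q.2) (hgpos q q.2)) (by positivity),
          Real.log_mul (hmpos q q.2).ne' (hgpos q q.2).ne',
          Real.log_mul (Real.exp_pos _).ne' hκ0.ne', Real.log_exp, hκ,
          Real.log_mul (hmpos b b.2).ne' (hgpos b b.2).ne']
        rw [revHoro, revFunkDist_eq hDopen hDconv hDbdd q.2, revFunkDist_eq hDopen hDconv hDbdd b.2,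
          funkBusemann_eq hEopen hz (hgpos b b.2),
          Real.log_div (hgpos q q.2).ne' (hgpos b b.2).ne'] at ht1
        linarith
      calc ⟪homLift x, u⟫ ≤ _ := e1
        _ ≤ gaugeM (coneOver D) (homLift x) (homLift (q : EuclideanSpace ℝ (Fin n))) *
            (gaugeM (E : Set (HomSpace n)) (homLift (q : EuclideanSpace ℝ (Fin n))) z * ⟪z, u⟫) :=
          mul_le_mul_of_nonneg_left e2 (hmpos q q.2).le
        _ = gaugeM (coneOver D) (homLift x) (homLift (q : EuclideanSpace ℝ (Fin n))) *
            gaugeM (E : Set (HomSpace n)) (homLift (q : EuclideanSpace ℝ (Fin n))) z * ⟪z, u⟫ := by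
          ring
        _ ≤ _ := mul_le_mul_of_nonneg_right e3 hzu
    have hlim0 : Tendsto (fun A : ℝ => Real.exp (1 - A) * κ * ⟪z, u⟫) atTop (𝓝 (0 * κ * ⟪z, u⟫)) :=
      ((Real.tendsto_exp_atBot.comp (tendsto_atBot_add_const_left atTop 1
        tendsto_neg_atTop_atBot)).mul_const κ).mul_const _
    simpa using ge_of_tendsto' hlim0 hbound
  · intro hface
    choose y hy1 hy2 hy3 using fun k : ℕ => exists_hilbert_realising_point hDopen hDconv hDbdd
      hEopen hext hEzero hz b hx.1 hface k k (Nat.one_div_pos_of_nat (α := ℝ) (n := k))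
    have hsmall : ∀ ε > 0, ∀ᶠ k : ℕ in atTop, 1 / ((k : ℝ) + 1) < ε := fun ε hε =>
      tendsto_one_div_add_atTop_nhds_zero_nat.eventually_lt_const hε
    refine isBusemannPoint_of_seq (fun p : D => hilbertDist_self (p : EuclideanSpace ℝ (Fin n)))
      (fun p q => hilbertDist_nonneg hDopen hDconv hDbdd p.2 q.2)
      (fun p q r => hilbertDist_triangle hDopen hDconv hDbdd p.2 q.2 r.2) y
      (tendsto_toUnif_iff.2 fun B hB => ?_) (tendsto_atTop_mono hy2 tendsto_natCast_atTop_atTop)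
      fun ε hε => (hsmall ε hε).mono fun k hk => (hy3 k).trans_lt hk
    obtain ⟨R, hR⟩ := exists_gaugeM_le_of_mem_symBoundedSets hDopen hDconv hDbdd b hB
    refine Metric.tendstoUniformlyOn_iff.2 fun ε hε => ?_
    filter_upwards [hsmall ε hε, tendsto_natCast_atTop_atTop.eventually_ge_atTop R] with k h1 h2
    intro p hp
    rw [dist_comm, Real.dist_eq]
    exact (hy1 k p ((hR p hp).trans h2)).trans_lt h1
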